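/- Let $(M,g,J)$ be a Kähler surface: a smooth Riemannian manifold of real dimension $4$ with Levi-Civita connection $\nabla$ and a smooth orthogonal almost complex structure $J$ such that $\nabla J=0$; let $\Omega(X,Y)=g(JX,Y)$ be its Kähler form and $R(X,Y)=[\nabla_X,\nabla_Y]-\nabla_{[X,Y]}$ its curvature. Assume that $(M,g)$ is semi-symmetric ($R(X,Y)\cdot R=0$ for all $X,Y$) and foliated by $2$-dimensional Euclidean spaces, i.e. the nullity distribution $$\mathcal D=\{X : R(U,V)X=0 \text{ for all } U,V\in TM\}$$ has rank $2$ at every point. Put $\mathcal E=\mathcal D^{\perp}$, let $\tau$ be the scalar curvature and $c=\tau/2$ (which vanishes nowhere), let $\theta$ be the $1$-form $\theta(X)=d(\ln|c|)(X_{\mathcal D})$, where $X_{\mathcal D}$ is the orthogonal projection of $X$ to $\mathcal D$, and let $\theta^\sharp$ be the vector field dual to $\theta$ with respect to $g$. Let $I$ be the almost complex structure with $I=J$ on $\mathcal D$ and $I=-J$ on $\mathcal E$. Then the following conditions are equivalent: (a) $d\theta=0$; (b) $J\theta^\sharp$ is a Hamiltonian vector field for $(M,g,J)$, i.e. there is a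 smooth function $H$ on $M$ with $\Omega(J\theta^\sharp,\cdot)=dH$; (c) $Y|\theta|^2=0$ for all $Y\in\mathcal E$. Moreover, if $I$ is integrable, then each of these conditions is equivalent to (e) $(M,g,I)$ is locally conformally Kähler, i.e. $I$ is integrable and every point has an open neighbourhood with a smooth function $f$ on it such that the $2$-form $e^{f}g(I\cdot,\cdot)$ is closed there. -/

import Mathlib

open Bundle
open scoped Manifold ContDiff InnerProductSpace

namespace KahlerSurface

noncomputable section

/-- The model space of real dimension four. -/
abbrev E4 : Type := EuclideanSpace ℝ (Fin 4)

/-- Vector fields on `M` (no smoothness assumed). -/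
abbrev TangentField (M : Type*) [TopologicalSpace M] [ChartedSpace E4 M] : Type _ :=
  Π x : M, TangentSpace (𝓡 4) x

/-- Fields of endomorphisms of the tangent spaces of `M`. -/
abbrev EndField (M : Type*) [TopologicalSpace M] [ChartedSpace E4 M] : Type _ :=
  Π x : M, TangentSpace (𝓡 4) x →L[ℝ] TangentSpace (𝓡 4) x

/-- 1-forms on `M`. -/
abbrev OneForm (M : Type*) [TopologicalSpace M] [ChartedSpace E4 M] : Type _ :=
  Π x : M, TangentSpace (𝓡 4) x →L[ℝ] ℝ

/-- Functions of two tangent vectors at a point of `M`; used only for 2-forms. -/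
abbrev TwoForm (M : Type*) [TopologicalSpace M] [ChartedSpace E4 M] : Type _ :=
  Π x : M, TangentSpace (𝓡 4) x → TangentSpace (𝓡 4) x → ℝ

/-- Affine connections (covariant derivatives on the tangent bundle).
`∇ Y x v` is the derivative of the vector field `Y` at `x` in the direction `v`. -/
abbrev Connection (M : Type*) [TopologicalSpace M] [ChartedSpace E4 M] [IsManifold (𝓡 4) ∞ M] :
    Type _ :=
  CovariantDerivative (𝓡 4) E4 (fun x : M ↦ TangentSpace (𝓡 4) x)

section Manifold

instance {M : Type*} [TopologicalSpace M] [ChartedSpace E4 M] (x : M) :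
    FiniteDimensional ℝ (TangentSpace (𝓡 4) x) :=
  inferInstanceAs (FiniteDimensional ℝ E4)

variable {M : Type*} [TopologicalSpace M] [ChartedSpace E4 M] [IsManifold (𝓡 4) ∞ M]

/-- The vector field `X` is smooth near the point `x`. -/
def SmoothFieldAt (X : TangentField M) (x : M) : Prop :=
  ContMDiffAt (𝓡 4) ((𝓡 4).prod 𝓘(ℝ, E4)) ∞ (fun y ↦ Bundle.TotalSpace.mk' E4 y (X y)) x

/-- The exterior derivative of a 1-form, evaluated on two vector fields:
`dα(X, Y) = X α(Y) - Y α(X) - α([X, Y])`. -/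
def extDerivOne (α : OneForm M) (X Y : TangentField M) (x : M) : ℝ :=
  mvfderiv (𝓡 4) (fun y ↦ α y (Y y)) x (X x) - mvfderiv (𝓡 4) (fun y ↦ α y (X y)) x (Y x)
    - α x (VectorField.mlieBracket (𝓡 4) X Y x)

/-- The 1-form `α` is closed: `dα = 0`. -/
def IsClosedOne (α : OneForm M) : Prop :=
  ∀ (x : M) (X Y : TangentField M), SmoothFieldAt X x → SmoothFieldAt Y x →
    extDerivOne α X Y x = 0

/-- The exterior derivative of a 2-form, evaluated on three vector fields: the cyclic sum of
`X β(Y, Z) - β([X, Y], Z)`. -/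
def extDerivTwo (β : TwoForm M) (X Y Z : TangentField M) (x : M) : ℝ :=
  mvfderiv (𝓡 4) (fun y ↦ β y (Y y) (Z y)) x (X x)
    + mvfderiv (𝓡 4) (fun y ↦ β y (Z y) (X y)) x (Y x)
    + mvfderiv (𝓡 4) (fun y ↦ β y (X y) (Y y)) x (Z x)
    - β x (VectorField.mlieBracket (𝓡 4) X Y x) (Z x)
    - β x (VectorField.mlieBracket (𝓡 4) Y Z x) (X x)
    - β x (VectorField.mlieBracket (𝓡 4) Z X x) (Y x)

/-- The 2-form `β` is closed on the open set `U`. -/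
def IsClosedTwoOn (β : TwoForm M) (U : Set M) : Prop :=
  ∀ x ∈ U, ∀ X Y Z : TangentField M,
    SmoothFieldAt X x → SmoothFieldAt Y x → SmoothFieldAt Z x → extDerivTwo β X Y Z x = 0

/-- The almost complex structure `K` is integrable: its Nijenhuis tensor
`[KX, KY] - K[KX, Y] - K[X, KY] - [X, Y]` vanishes. -/
def IsIntegrable (K : EndField M) : Prop :=
  ∀ (x : M) (X Y : TangentField M), SmoothFieldAt X x → SmoothFieldAt Y x →
    VectorField.mlieBracket (𝓡 4) (fun y ↦ K y (X y)) (fun y ↦ K y (Y y)) x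
      - K x (VectorField.mlieBracket (𝓡 4) (fun y ↦ K y (X y)) Y x)
      - K x (VectorField.mlieBracket (𝓡 4) X (fun y ↦ K y (Y y)) x)
      - VectorField.mlieBracket (𝓡 4) X Y x = 0

/-- `R(X, Y)Z = ∇_X ∇_Y Z - ∇_Y ∇_X Z - ∇_[X, Y] Z` for vector fields `X`, `Y`, `Z`. -/
def curvatureField (cov : Connection M) (X Y Z : TangentField M) (x : M) :
    TangentSpace (𝓡 4) x :=
  cov (fun y ↦ cov Z y (Y y)) x (X x) - cov (fun y ↦ cov Z y (X y)) x (Y x)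
    - cov Z x (VectorField.mlieBracket (𝓡 4) X Y x)

/-- The curvature tensor `R(u, v)w` on tangent vectors at `x`, computed on Mathlib's canonical
extensions of `u`, `v`, `w` to vector fields that are smooth near `x`. -/
def curvature (cov : Connection M) (x : M) (u v w : TangentSpace (𝓡 4) x) : TangentSpace (𝓡 4) x :=
  curvatureField cov (FiberBundle.extend E4 u) (FiberBundle.extend E4 v)
    (FiberBundle.extend E4 w) x

/-- The condition `R . R = 0`, where `R(u, v)` acts on `R` as a derivation. -/
def IsSemiSymmetric (cov : Connection M) : Prop :=
  ∀ (x : M) (u v a b c : TangentSpace (𝓡 4) x),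
    curvature cov x u v (curvature cov x a b c)
      - curvature cov x (curvature cov x u v a) b c
      - curvature cov x a (curvature cov x u v b) c
      - curvature cov x a b (curvature cov x u v c) = 0

/-- The nullity distribution `V⁰ = {w : R(u, v)w = 0 for all u, v}` (this set is a linear
subspace, since `R` is a tensor). -/
def nullity (cov : Connection M) (x : M) : Submodule ℝ (TangentSpace (𝓡 4) x) :=
  Submodule.span ℝ {w | ∀ u v : TangentSpace (𝓡 4) x, curvature cov x u v w = 0}

variable [RiemannianBundle (fun x : M ↦ TangentSpace (𝓡 4) x)]
  [IsContMDiffRiemannianBundle (𝓡 4) ∞ E4 (fun x : M ↦ TangentSpace (𝓡 4) x)]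

instance : IsContMDiffRiemannianBundle (𝓡 4) 1 E4 (fun x : M ↦ TangentSpace (𝓡 4) x) :=
  IsContMDiffRiemannianBundle.of_le (n := ∞) (by exact_mod_cast le_top)

/-- `cov` is the Levi-Civita connection of the Riemannian metric: it is smooth, metric and
torsion-free. -/
structure IsLeviCivita (cov : Connection M) : Prop where
  smooth : ∀ U : Set M, IsOpen U → ContMDiffCovariantDerivativeOn E4 ∞ cov U
  metric : cov.IsMetricCompatible
  torsion_free : cov.torsion = 0

/-- `(g, J)` is a Kähler structure, where `cov` is the Levi-Civita connection of `g`: `J` is a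
smooth orthogonal almost complex structure and `∇J = 0`. -/
structure IsKahler (cov : Connection M) (J : EndField M) : Prop where
  smooth : ContMDiff (𝓡 4) ((𝓡 4).prod 𝓘(ℝ, E4 →L[ℝ] E4)) ∞
    (fun x ↦ Bundle.TotalSpace.mk' (E4 →L[ℝ] E4)
      (E := fun x : M ↦ TangentSpace (𝓡 4) x →L[ℝ] TangentSpace (𝓡 4) x) x (J x))
  sq : ∀ (x : M) (v : TangentSpace (𝓡 4) x), J x (J x v) = -v
  orthogonal : ∀ (x : M) (v w : TangentSpace (𝓡 4) x), ⟪J x v, J x w⟫_ℝ = ⟪v, w⟫_ℝ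
  parallel : ∀ (x : M) (Y : TangentField M), SmoothFieldAt Y x →
    ∀ v : TangentSpace (𝓡 4) x, cov (fun y ↦ J y (Y y)) x v = J x (cov Y x v)

/-- The fundamental 2-form `(v, w) ↦ g(Kv, w)`. -/
def fundamentalForm (K : EndField M) (x : M) (v w : TangentSpace (𝓡 4) x) : ℝ :=
  ⟪K x v, w⟫_ℝ

/-- The scalar curvature `τ = ∑ᵢⱼ g(R(eᵢ, eⱼ)eⱼ, eᵢ)` for an orthonormal basis `e`. -/
def scalarCurvature (cov : Connection M) (x : M) : ℝ :=
  let e := stdOrthonormalBasis ℝ (TangentSpace (𝓡 4) x)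
  ∑ i, ∑ j, ⟪curvature cov x (e i) (e j) (e j), e i⟫_ℝ

/-- The 1-form `θ(v) = d(ln |c|)(p_D v)`, where `c = τ / 2` and `p_D` is the orthogonal projection
to `D = V⁰`. (`Real.log c` is `ln |c|`.) -/
def theta (cov : Connection M) (x : M) : TangentSpace (𝓡 4) x →L[ℝ] ℝ :=
  (mvfderiv (𝓡 4) (fun y : M ↦ Real.log (scalarCurvature cov y / 2)) x).comp
    (nullity cov x).starProjection

/-- The vector field `θ^♯` dual to `θ`. -/
def thetaSharp (cov : Connection M) (x : M) : TangentSpace (𝓡 4) x :=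
  (InnerProductSpace.toDual ℝ (TangentSpace (𝓡 4) x)).symm (theta cov x)

/-- The almost complex structure `I` with `I = J` on `D = V⁰` and `I = -J` on `E = Dᗮ`. -/
def opposite (cov : Connection M) (J : EndField M) (x : M) :
    TangentSpace (𝓡 4) x →L[ℝ] TangentSpace (𝓡 4) x :=
  (J x).comp ((nullity cov x).starProjection - (nullity cov x)ᗮ.starProjection)

/-- The vector field `V` is Hamiltonian with respect to the 2-form `Ω`: `Ω(V, ·) = dH` for some
smooth function `H`. -/
def IsHamiltonian (Ω : TwoForm M) (V : TangentField M) : Prop :=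
  ∃ H : M → ℝ, ContMDiff (𝓡 4) 𝓘(ℝ, ℝ) ∞ H ∧
    ∀ (x : M) (w : TangentSpace (𝓡 4) x), Ω x (V x) w = mvfderiv (𝓡 4) H x w

/-- `(M, g, K)` is locally conformally Kähler: `K` is integrable and every point has an open
neighbourhood `U` with a smooth function `f` such that the fundamental form of `(e^f g, K)` is
closed on `U`. -/
def IsLocallyConformallyKahler (K : EndField M) : Prop :=
  IsIntegrable K ∧ ∀ p : M, ∃ U : Set M, IsOpen U ∧ p ∈ U ∧
    ∃ f : M → ℝ, ContMDiffOn (𝓡 4) 𝓘(ℝ, ℝ) ∞ f U ∧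
      IsClosedTwoOn (fun x v w ↦ Real.exp (f x) * fundamentalForm K x v w) U

end Manifold

end

end KahlerSurface

/-! Near every point there is a smooth unitary frame `e 0`, `e 1 = J (e 0)` of `E = Dᗮ` and `e 2`,
`e 3 = J (e 2)` of `D`. In it the whole curvature is `c` times one term supported on `E`, so `c` is
the only curvature invariant. The second Bianchi identity then says that `D` is totally geodesic and
that `θ` on `D` is minus the trace of `X ↦ (∇_X T)_E` on `E`, for `T ∈ D`. Vanishing of `R(T, ·)`
turns into Riccati equations for these operators along `D` (`dir_two_coef`, `dir_three_coef`).

Let `δ` be the determinant of `X ↦ (∇_X e₂)_E`; it equals `-div θ^♯ / 4` (`twist_eq`), so it is a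
global function. The Riccati equations give, along `D`, `dδ = δ θ` and `d|θ|² = 2(|θ|² - 2δ) θ`,
while `4δ ≤ |θ|²` is a sum of squares. They also show that `dθ` vanishes on `D × D`; it vanishes on
`E × E` too, so only its mixed part matters.

(a) ⇔ (c): for `Y ∈ E` one has `Y|θ|² = 2 dθ(Y, θ^♯)`, so (a) implies (c). Given (c), `d|θ|² = g θ`
with `g = 2(|θ|² - 2δ)`, hence `dg ∧ θ + g dθ = 0`. Contracting with `θ^♯` kills `dg` on `E`, and `g
≥ |θ|² > 0` wherever `θ ≠ 0`, so `dθ = 0` there; continuity and the trivial case of an open set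
where `θ = 0` do the rest (`mixed_eq_zero`).

(a) ⇔ (b): `Ω(Jθ^♯, ·) = -θ`, so (b) says that `θ` is exact, and the point is to get exactness from
closedness without any topology. If `dθ = 0`, then `dδ = δ θ` and `d(|θ|² - 4δ) = 2(|θ|² - 4δ) θ` on
all of `M`. Each of these functions vanishes on an open and closed set, so `log |δ|`, or else `½ log
(|θ|² - 4δ)`, or else `0`, is a global potential (`exists_potential`).

(a) ⇔ (e): with `Ω_I` the fundamental form of `I`, `d(e^f Ω_I) = e^f (df ∧ Ω_I + 2 θ ∧ e⁰ ∧ e¹)`,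
and this vanishes exactly when `df = 2θ`. Local solvability of that equation gives closedness, and
the global potential gives a conformal factor. -/

namespace KahlerSurface

set_option linter.unusedSectionVars false
set_option linter.unusedSimpArgs false

open Filter Topology VectorField

/-! ### Smoothness near a point and directional derivatives. -/

section Calculus

variable {M : Type*} [TopologicalSpace M] [ChartedSpace E4 M] [IsManifold (𝓡 4) ∞ M]

/-- Differentiability of a vector field at a point. -/
abbrev DiffFieldAt (X : TangentField M) (x : M) : Prop :=
  MDifferentiableAt (𝓡 4) ((𝓡 4).prod 𝓘(ℝ, E4)) (fun y ↦ Bundle.TotalSpace.mk' E4 y (X y)) x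

/-- Differentiability of a function at a point. -/
abbrev DiffFnAt (f : M → ℝ) (x : M) : Prop := MDifferentiableAt (𝓡 4) 𝓘(ℝ, ℝ) f x

/-- The vector field `X` is smooth at every point of some neighbourhood of `x`. -/
def SmoothNear (X : TangentField M) (x : M) : Prop := ∀ᶠ y in 𝓝 x, SmoothFieldAt X y

/-- The function `f` is smooth at every point of some neighbourhood of `x`. -/
def FnSmoothNear (f : M → ℝ) (x : M) : Prop := ∀ᶠ y in 𝓝 x, ContMDiffAt (𝓡 4) 𝓘(ℝ, ℝ) ∞ f y

/-- The derivative of `f` along the vector field `X`. -/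
noncomputable def dir (X : TangentField M) (f : M → ℝ) (x : M) : ℝ := mvfderiv (𝓡 4) f x (X x)

lemma isManifold_infty_add_one : IsManifold (𝓡 4) (∞ + 1) M :=
  inferInstanceAs (IsManifold (𝓡 4) ∞ M)

lemma isManifold_three : IsManifold (𝓡 4) 3 M := IsManifold.of_le (n := ∞) (ENat.LEInfty.out)

attribute [local instance] isManifold_infty_add_one isManifold_three

lemma SmoothNear.self {X : TangentField M} {x : M} (h : SmoothNear X x) : SmoothFieldAt X x :=
  h.self_of_nhds

lemma FnSmoothNear.self {f : M → ℝ} {x : M} (h : FnSmoothNear f x) :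
    ContMDiffAt (𝓡 4) 𝓘(ℝ, ℝ) ∞ f x := h.self_of_nhds

lemma SmoothNear.eventually {X : TangentField M} {x : M} (h : SmoothNear X x) :
    ∀ᶠ y in 𝓝 x, SmoothNear X y := eventually_eventually_nhds.2 h

lemma FnSmoothNear.eventually {f : M → ℝ} {x : M} (h : FnSmoothNear f x) :
    ∀ᶠ y in 𝓝 x, FnSmoothNear f y := eventually_eventually_nhds.2 h

lemma SmoothFieldAt.mdiff {X : TangentField M} {x : M} (h : SmoothFieldAt X x) :
    DiffFieldAt X x := ContMDiffAt.mdifferentiableAt h (by simp)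

lemma SmoothNear.mdiff {X : TangentField M} {x : M} (h : SmoothNear X x) :
    DiffFieldAt X x := h.self.mdiff

lemma FnSmoothNear.mdiff {f : M → ℝ} {x : M} (h : FnSmoothNear f x) :
    DiffFnAt f x := h.self.mdifferentiableAt (by simp)

lemma SmoothNear.add {X Y : TangentField M} {x : M} (hX : SmoothNear X x) (hY : SmoothNear Y x) :
    SmoothNear (X + Y) x := by
  filter_upwards [hX, hY] with y h1 h2 using ContMDiffAt.add_section h1 h2

lemma SmoothNear.sub {X Y : TangentField M} {x : M} (hX : SmoothNear X x) (hY : SmoothNear Y x) :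
    SmoothNear (X - Y) x := by
  filter_upwards [hX, hY] with y h1 h2 using ContMDiffAt.sub_section h1 h2

lemma FnSmoothNear.smul {f : M → ℝ} {X : TangentField M} {x : M} (hf : FnSmoothNear f x)
    (hX : SmoothNear X x) : SmoothNear (f • X) x := by
  filter_upwards [hf, hX] with y h1 h2 using ContMDiffAt.smul_section h1 h2

lemma SmoothNear.congr {X Y : TangentField M} {x : M} (hX : SmoothNear X x)
    (h : ∀ᶠ y in 𝓝 x, Y y = X y) : SmoothNear Y x := by
  filter_upwards [hX, eventually_eventually_nhds.2 h] with y h1 h2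
  exact ContMDiffAt.congr_of_eventuallyEq h1 (h2.mono fun z hz ↦ by simp [hz])

lemma FnSmoothNear.congr {f g : M → ℝ} {x : M} (hf : FnSmoothNear f x)
    (h : g =ᶠ[𝓝 x] f) : FnSmoothNear g x := by
  filter_upwards [hf, eventually_eventually_nhds.2 h] with y h1 h2
  exact ContMDiffAt.congr_of_eventuallyEq h1 h2

lemma FnSmoothNear.add {f g : M → ℝ} {x : M} (hf : FnSmoothNear f x) (hg : FnSmoothNear g x) :
    FnSmoothNear (fun y ↦ f y + g y) x := by
  filter_upwards [hf, hg] with y h1 h2 using h1.add h2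

lemma FnSmoothNear.sub {f g : M → ℝ} {x : M} (hf : FnSmoothNear f x) (hg : FnSmoothNear g x) :
    FnSmoothNear (fun y ↦ f y - g y) x := by
  filter_upwards [hf, hg] with y h1 h2 using h1.sub h2

lemma FnSmoothNear.mul {f g : M → ℝ} {x : M} (hf : FnSmoothNear f x) (hg : FnSmoothNear g x) :
    FnSmoothNear (fun y ↦ f y * g y) x := by
  filter_upwards [hf, hg] with y h1 h2 using h1.mul h2

lemma FnSmoothNear.neg {f : M → ℝ} {x : M} (hf : FnSmoothNear f x) :
    FnSmoothNear (fun y ↦ - f y) x := by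
  filter_upwards [hf] with y h1 using h1.neg

lemma FnSmoothNear.const (a : ℝ) (x : M) : FnSmoothNear (fun _ ↦ a) x :=
  Eventually.of_forall fun _ ↦ contMDiffAt_const

lemma FnSmoothNear.comp {f : M → ℝ} {g : ℝ → ℝ} {x : M} (hf : FnSmoothNear f x)
    (hg : ∀ᶠ t in 𝓝 (f x), ContDiffAt ℝ ∞ g t) : FnSmoothNear (fun y ↦ g (f y)) x := by
  filter_upwards [hf, hf.self.continuousAt.eventually hg] with y h1 h2
  exact h2.contMDiffAt.comp y h1

lemma smoothNear_extend {x : M} (v : TangentSpace (𝓡 4) x) :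
    SmoothNear (FiberBundle.extend E4 v) x := by
  obtain ⟨s, hs, h⟩ := FiberBundle.exists_contMDiffOn_extend (k := ∞) (𝓡 4) E4 v
  filter_upwards [eventually_mem_nhds_iff.2 hs] with y hy using h.contMDiffAt hy

/-! ### Directional derivatives -/

lemma contMDiffAt_dir {f : M → ℝ} {X : TangentField M} {x : M}
    (hf : ContMDiffAt (𝓡 4) 𝓘(ℝ, ℝ) ∞ f x) (hX : SmoothFieldAt X x) :
    ContMDiffAt (𝓡 4) 𝓘(ℝ, ℝ) ∞ (dir X f) x := by
  have h1 := hf.mfderiv_const (m := ∞) le_rfl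
  have h2 : ContMDiffAt (𝓡 4) (𝓘(ℝ, ℝ).prod 𝓘(ℝ, ℝ)) ∞
      (fun y ↦ (⟨f y, mfderiv (𝓡 4) 𝓘(ℝ, ℝ) f y (X y)⟩ : TangentBundle 𝓘(ℝ, ℝ) ℝ)) x :=
    ContMDiffAt.clm_apply_of_inCoordinates h1 hX hf
  rw [contMDiffAt_totalSpace] at h2
  simpa using! h2.2

lemma FnSmoothNear.dir {f : M → ℝ} {X : TangentField M} {x : M}
    (hf : FnSmoothNear f x) (hX : SmoothNear X x) : FnSmoothNear (dir X f) x := by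
  filter_upwards [hf, hX] with y h1 h2 using contMDiffAt_dir h1 h2

lemma mvfderiv_congr {f g : M → ℝ} {x : M} (h : f =ᶠ[𝓝 x] g) :
    mvfderiv (𝓡 4) f x = mvfderiv (𝓡 4) g x := by
  have h0 := h.mfderiv_eq (I := 𝓡 4) (I' := 𝓘(ℝ, ℝ))
  have h1 := h.self_of_nhds
  ext v
  simp only [mvfderiv]
  exact congr($h0 v)

lemma dir_congr {f g : M → ℝ} {X : TangentField M} {x : M} (h : f =ᶠ[𝓝 x] g) :
    dir X f x = dir X g x := by
  rw [dir, dir, mvfderiv_congr h]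

lemma dir_mul {f g : M → ℝ} {X : TangentField M} {x : M} (hf : DiffFnAt f x) (hg : DiffFnAt g x) :
    dir X (fun y ↦ f y * g y) x = f x * dir X g x + g x * dir X f x := by
  simp [dir, mvfderiv_fun_mul hf hg]

lemma dir_add {f g : M → ℝ} {X : TangentField M} {x : M} (hf : DiffFnAt f x) (hg : DiffFnAt g x) :
    dir X (fun y ↦ f y + g y) x = dir X f x + dir X g x := by
  simp [dir, mvfderiv_fun_add hf hg]

lemma dir_sub {f g : M → ℝ} {X : TangentField M} {x : M} (hf : DiffFnAt f x) (hg : DiffFnAt g x) :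
    dir X (fun y ↦ f y - g y) x = dir X f x - dir X g x := by
  simp [dir, mvfderiv_fun_sub hf hg]

lemma dir_const (a : ℝ) (X : TangentField M) (x : M) : dir X (fun _ ↦ a) x = 0 := by
  simp [dir, mvfderiv_const]

lemma mvfderiv_comp_real {f : M → ℝ} {g : ℝ → ℝ} {g' : ℝ} {x : M}
    (hg : HasDerivAt g g' (f x)) (hf : DiffFnAt f x) (v : TangentSpace (𝓡 4) x) :
    mvfderiv (𝓡 4) (fun y ↦ g (f y)) x v = g' * mvfderiv (𝓡 4) f x v := by
  have h := (hg.hasFDerivAt.hasMFDerivAt.comp x hf.hasMFDerivAt).mfderiv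
  have := congr($h v)
  simp only [mvfderiv]
  exact this.trans (mul_comm (show ℝ from mfderiv (𝓡 4) 𝓘(ℝ, ℝ) f x v) g')

end Calculus

/-! ### Lie brackets and the commutator of two directional derivatives. -/

section Commutator

variable {M : Type*} [TopologicalSpace M] [ChartedSpace E4 M] [IsManifold (𝓡 4) ∞ M]

attribute [local instance] isManifold_infty_add_one isManifold_three

lemma isManifold_minSmoothness_three : IsManifold (𝓡 4) (minSmoothness ℝ 3) M := by
  simpa using (inferInstance : IsManifold (𝓡 4) 3 M)

attribute [local instance] isManifold_minSmoothness_three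

/-- The Lie bracket of vector fields. -/
noncomputable abbrev brk (X Y : TangentField M) : TangentField M := mlieBracket (𝓡 4) X Y

lemma SmoothFieldAt.brk {X Y : TangentField M} {x : M} (hX : SmoothFieldAt X x)
    (hY : SmoothFieldAt Y x) : SmoothFieldAt (brk X Y) x :=
  ContMDiffAt.mlieBracket_vectorField (m := ⊤) (n := ⊤) hX hY (by simp)

lemma SmoothNear.brk {X Y : TangentField M} {x : M} (hX : SmoothNear X x)
    (hY : SmoothNear Y x) : SmoothNear (brk X Y) x := by
  filter_upwards [hX, hY] with y h1 h2 using h1.brk h2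

lemma brk_smul_right {f : M → ℝ} {X W : TangentField M} {x : M} (hf : DiffFnAt f x)
    (hW : DiffFieldAt W x) :
    brk X (f • W) x = dir X f x • W x + f x • brk X W x :=
  mlieBracket_smul_right hf hW

lemma jacobi {X Y Z : TangentField M} {x : M} (hX : SmoothFieldAt X x) (hY : SmoothFieldAt Y x)
    (hZ : SmoothFieldAt Z x) :
    brk X (brk Y Z) x = brk (brk X Y) Z x + brk Y (brk X Z) x := by
  have h : minSmoothness ℝ 2 ≤ (∞ : ℕ∞ω) := by simpa using ENat.LEInfty.out
  exact leibniz_identity_mlieBracket_apply (hX.of_le h) (hY.of_le h) (hZ.of_le h)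

/-- Smoothness of order `∞` at a point yields a neighbourhood for each finite order but not a common
one, so only first order is propagated to nearby points here. -/
lemma SmoothFieldAt.eventually_diff {X : TangentField M} {x : M} (h : SmoothFieldAt X x) :
    ∀ᶠ y in 𝓝 x, DiffFieldAt X y := by
  have h1 : ContMDiffAt (𝓡 4) ((𝓡 4).prod 𝓘(ℝ, E4)) 1
    (fun y ↦ Bundle.TotalSpace.mk' E4 y (X y)) x := ContMDiffAt.of_le h ENat.LEInfty.out
  filter_upwards [(contMDiffAt_iff_contMDiffAt_nhds (by simp)).1 h1] with y hy using
    ContMDiffAt.mdifferentiableAt hy (by simp)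

lemma ContMDiffAt.eventually_diffFn {f : M → ℝ} {x : M}
    (h : ContMDiffAt (𝓡 4) 𝓘(ℝ, ℝ) ∞ f x) : ∀ᶠ y in 𝓝 x, DiffFnAt f y := by
  have h1 : ContMDiffAt (𝓡 4) 𝓘(ℝ, ℝ) 1 f x := ContMDiffAt.of_le h ENat.LEInfty.out
  filter_upwards [(contMDiffAt_iff_contMDiffAt_nhds (by simp)).1 h1] with y hy using
    ContMDiffAt.mdifferentiableAt hy (by simp)

lemma SmoothFieldAt.smul {f : M → ℝ} {X : TangentField M} {x : M}
    (hf : ContMDiffAt (𝓡 4) 𝓘(ℝ, ℝ) ∞ f x) (hX : SmoothFieldAt X x) :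
    SmoothFieldAt (f • X) x := ContMDiffAt.smul_section hf hX

lemma brk_brk_smul {f : M → ℝ} {X Y W : TangentField M} {x : M}
    (hf : ContMDiffAt (𝓡 4) 𝓘(ℝ, ℝ) ∞ f x) (hY : SmoothFieldAt Y x) (hW : SmoothFieldAt W x) :
    brk X (brk Y (f • W)) x = dir X (dir Y f) x • W x + dir Y f x • brk X W x
      + dir X f x • brk Y W x + f x • brk X (brk Y W) x := by
  have h1 : ∀ᶠ y in 𝓝 x, brk Y (f • W) y = (dir Y f • W + f • brk Y W) y := by
    filter_upwards [ContMDiffAt.eventually_diffFn hf, hW.eventually_diff] with y h1 h2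
    exact brk_smul_right h1 h2
  have hd := contMDiffAt_dir hf hY
  have hB := hY.brk hW
  rw [brk, EventuallyEq.mlieBracket_vectorField_eq (EventuallyEq.refl _ X) h1,
    mlieBracket_add_right (SmoothFieldAt.smul hd hW).mdiff (SmoothFieldAt.smul hf hB).mdiff,
    ← brk, ← brk, brk_smul_right (hd.mdifferentiableAt (by simp)) hW.mdiff,
    brk_smul_right (hf.mdifferentiableAt (by simp)) hB.mdiff]
  abel

/-- `X (Y f) - Y (X f) = [X, Y] f`. -/
lemma dir_comm {f : M → ℝ} {X Y : TangentField M} {x : M}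
    (hf : ContMDiffAt (𝓡 4) 𝓘(ℝ, ℝ) ∞ f x) (hX : SmoothFieldAt X x) (hY : SmoothFieldAt Y x) :
    dir X (dir Y f) x - dir Y (dir X f) x = dir (brk X Y) f x := by
  -- The Jacobi identity for `X`, `Y`, `f • W` minus `f` times the one for `X`, `Y`, `W` leaves
  -- `(XYf - YXf - [X,Y]f) W`. A field `W` with `W x ≠ 0` then isolates the coefficient, without
  -- coordinates.
  obtain ⟨w, hw⟩ := exists_ne (0 : E4)
  let W : TangentField M := FiberBundle.extend E4 (show TangentSpace (𝓡 4) x from w)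
  have hW : SmoothFieldAt W x := (smoothNear_extend _).self
  have hWx : W x = w := FiberBundle.extend_apply_self (F := E4) (show TangentSpace (𝓡 4) x from w)
  have h1 := jacobi hX hY (SmoothFieldAt.smul hf hW)
  rw [brk_brk_smul hf hY hW, brk_brk_smul hf hX hW,
    brk_smul_right (hf.mdifferentiableAt (by simp)) hW.mdiff, jacobi hX hY hW] at h1
  have h2 : (dir X (dir Y f) x - dir Y (dir X f) x - dir (brk X Y) f x) • W x = 0 := by
    rw [sub_smul, sub_smul, sub_sub, sub_eq_zero]
    have h3 := sub_eq_zero.2 h1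
    rw [← sub_eq_zero, ← h3, smul_add]
    abel
  rcases smul_eq_zero.1 h2 with h | h
  · linarith
  · exact absurd (hWx.symm.trans h) hw

end Commutator

/-! ### Rules for the Levi-Civita connection. -/

section Connection

variable {M : Type*} [TopologicalSpace M] [ChartedSpace E4 M] [IsManifold (𝓡 4) ∞ M]

/-- `∇_X Y`. -/
noncomputable abbrev nab (cov : Connection M) (X Y : TangentField M) : TangentField M := fun y ↦ cov Y y (X y)

variable {cov : Connection M} {X Y Z W : TangentField M} {x : M}

lemma cov_add (hY : DiffFieldAt Y x) (hZ : DiffFieldAt Z x) (v : TangentSpace (𝓡 4) x) :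
    cov (Y + Z) x v = cov Y x v + cov Z x v := by
  rw [cov.isCovariantDerivativeOn.add hY hZ]; rfl

lemma cov_sub (hY : DiffFieldAt Y x) (hZ : DiffFieldAt Z x) (v : TangentSpace (𝓡 4) x) :
    cov (Y - Z) x v = cov Y x v - cov Z x v := by
  have h : DiffFieldAt (Y - Z) x := mdifferentiableAt_sub_section hY hZ
  have := cov_add (cov := cov) h hZ v
  rw [sub_add_cancel] at this
  rw [this, add_sub_cancel_right]

lemma cov_smul {f : M → ℝ} (hf : DiffFnAt f x) (hY : DiffFieldAt Y x) (v : TangentSpace (𝓡 4) x) :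
    cov (f • Y) x v = f x • cov Y x v + mvfderiv (𝓡 4) f x v • Y x := by
  rw [cov.isCovariantDerivativeOn.leibniz hY hf]; rfl

lemma cov_congr (hY : DiffFieldAt Y x) (hZ : DiffFieldAt Z x) (h : ∀ᶠ y in 𝓝 x, Y y = Z y) :
    cov Y x = cov Z x :=
  cov.isCovariantDerivativeOn.congr_of_eventuallyEq hY hZ univ_mem h

variable [RiemannianBundle (fun x : M ↦ TangentSpace (𝓡 4) x)]
  [IsContMDiffRiemannianBundle (𝓡 4) ∞ E4 (fun x : M ↦ TangentSpace (𝓡 4) x)]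

lemma SmoothNear.inner (hX : SmoothNear X x) (hY : SmoothNear Y x) :
    FnSmoothNear (fun y ↦ ⟪X y, Y y⟫_ℝ) x := by
  filter_upwards [hX, hY] with y h1 h2
  exact ContMDiffAt.inner_bundle h1 h2

lemma SmoothNear.nab (hcov : IsLeviCivita cov) (hX : SmoothNear X x) (hY : SmoothNear Y x) :
    SmoothNear (nab cov X Y) x := by
  obtain ⟨U, hU, hUo, hxU⟩ := eventually_nhds_iff.1 (hX.and hY)
  have h1 : ContMDiffOn (𝓡 4) ((𝓡 4).prod 𝓘(ℝ, E4)) (∞ + 1)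
    (fun y ↦ Bundle.TotalSpace.mk' E4 y (Y y)) U := fun y hy ↦ (hU y hy).2.contMDiffWithinAt
  have h2 := (hcov.smooth U hUo).contMDiff h1
  filter_upwards [hUo.mem_nhds hxU] with y hy
  exact ContMDiffAt.clm_bundle_apply (h2.contMDiffAt (hUo.mem_nhds hy)) (hU y hy).1

lemma IsLeviCivita.torsion (hcov : IsLeviCivita cov) (hX : DiffFieldAt X x) (hY : DiffFieldAt Y x) :
    brk X Y x = cov Y x (X x) - cov X x (Y x) :=
  ((cov.torsion_eq_zero_iff.1 hcov.torsion_free) hX hY).symm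

lemma IsLeviCivita.mvfderiv_inner (hcov : IsLeviCivita cov) (hX : DiffFieldAt X x)
    (hY : DiffFieldAt Y x) (v : TangentSpace (𝓡 4) x) :
    mvfderiv (𝓡 4) (fun y ↦ ⟪X y, Y y⟫_ℝ) x v = ⟪cov X x v, Y x⟫_ℝ + ⟪X x, cov Y x v⟫_ℝ := by
  have := hcov.metric.mvfderiv_inner_eq (FiberBundle.extend E4 v) hX hY
  simpa using this

lemma IsLeviCivita.dir_inner (hcov : IsLeviCivita cov) (hX : DiffFieldAt X x)
    (hY : DiffFieldAt Y x) :
    dir Z (fun y ↦ ⟪X y, Y y⟫_ℝ) x = ⟪nab cov Z X x, Y x⟫_ℝ + ⟪X x, nab cov Z Y x⟫_ℝ :=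
  hcov.mvfderiv_inner hX hY _

end Connection

/-! ### Symmetries of the curvature, tensoriality, Bianchi identities and compatibility with `J`. -/

section Curvature

variable {M : Type*} [TopologicalSpace M] [ChartedSpace E4 M] [IsManifold (𝓡 4) ∞ M]
  {cov : Connection M} {X X' Y Y' Z Z' W W' : TangentField M} {x : M}

lemma brk_swap (X Y : TangentField M) (x : M) : brk X Y x = - brk Y X x :=
  mlieBracket_swap_apply

lemma curvatureField_swap (X Y Z : TangentField M) (x : M) :
    curvatureField cov X Y Z x = - curvatureField cov Y X Z x := by
  simp only [curvatureField]
  rw [mlieBracket_swap_apply, map_neg]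
  abel

variable [RiemannianBundle (fun x : M ↦ TangentSpace (𝓡 4) x)]
  [IsContMDiffRiemannianBundle (𝓡 4) ∞ E4 (fun x : M ↦ TangentSpace (𝓡 4) x)]

lemma SmoothNear.curvatureField (hcov : IsLeviCivita cov) (hX : SmoothNear X x)
    (hY : SmoothNear Y x) (hZ : SmoothNear Z x) :
    SmoothNear (curvatureField cov X Y Z) x :=
  ((hX.nab hcov (hY.nab hcov hZ)).sub (hY.nab hcov (hX.nab hcov hZ))).sub
    ((hX.brk hY).nab hcov hZ)

lemma inner_curvatureField (hcov : IsLeviCivita cov) (hX : SmoothNear X x)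
    (hY : SmoothNear Y x) (hZ : SmoothNear Z x) (hW : SmoothNear W x) :
    ⟪curvatureField cov X Y Z x, W x⟫_ℝ =
      dir X (fun y ↦ ⟪nab cov Y Z y, W y⟫_ℝ) x - dir Y (fun y ↦ ⟪nab cov X Z y, W y⟫_ℝ) x
        - ⟪cov Z x (brk X Y x), W x⟫_ℝ
        - ⟪nab cov Y Z x, nab cov X W x⟫_ℝ + ⟪nab cov X Z x, nab cov Y W x⟫_ℝ := by
  rw [hcov.dir_inner (hY.nab hcov hZ).mdiff hW.mdiff, hcov.dir_inner (hX.nab hcov hZ).mdiff hW.mdiff]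
  simp only [KahlerSurface.curvatureField, inner_sub_left]
  ring

/-- Apply `XY - YX - [X,Y] = 0` to the function `⟪Z, W⟫` and expand by metric compatibility. -/
lemma inner_curvatureField_skew (hcov : IsLeviCivita cov) (hX : SmoothNear X x)
    (hY : SmoothNear Y x) (hZ : SmoothNear Z x) (hW : SmoothNear W x) :
    ⟪curvatureField cov X Y Z x, W x⟫_ℝ = - ⟪curvatureField cov X Y W x, Z x⟫_ℝ := by
  have key : ∀ V : TangentField M, SmoothNear V x → ∀ᶠ y in 𝓝 x,
      dir V (fun z ↦ ⟪Z z, W z⟫_ℝ) y = ⟪nab cov V Z y, W y⟫_ℝ + ⟪nab cov V W y, Z y⟫_ℝ := by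
    intro V hV
    filter_upwards [hZ.eventually, hW.eventually] with y h1 h2
    rw [hcov.dir_inner h1.mdiff h2.mdiff, real_inner_comm (nab cov V W y)]
  have h2 : ∀ U V : TangentField M, SmoothNear V x →
      dir U (dir V (fun z ↦ ⟪Z z, W z⟫_ℝ)) x =
        dir U (fun y ↦ ⟪nab cov V Z y, W y⟫_ℝ) x + dir U (fun y ↦ ⟪nab cov V W y, Z y⟫_ℝ) x := by
    intro U V hV
    rw [dir_congr (key V hV), dir_add ((hV.nab hcov hZ).inner hW).mdiff
      ((hV.nab hcov hW).inner hZ).mdiff]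
  have h3 := dir_comm (hZ.inner hW).self hX.self hY.self
  rw [h2 X Y hY, h2 Y X hX, (key _ (hX.brk hY)).self_of_nhds] at h3
  rw [inner_curvatureField hcov hX hY hZ hW, inner_curvatureField hcov hX hY hW hZ,
    real_inner_comm (nab cov X W x), real_inner_comm (nab cov Y W x)]
  linarith

/-- Zero torsion groups the second covariant derivatives into iterated brackets, and the cyclic sum
becomes the Jacobi identity. -/
lemma first_bianchi (hcov : IsLeviCivita cov) (hX : SmoothNear X x)
    (hY : SmoothNear Y x) (hZ : SmoothNear Z x) :
    curvatureField cov X Y Z x + curvatureField cov Y Z X x + curvatureField cov Z X Y x = 0 := by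
  have key : ∀ A B C : TangentField M, SmoothNear A x → SmoothNear B x → SmoothNear C x →
      cov (nab cov B C) x (A x) - cov (nab cov C B) x (A x) - cov A x (brk B C x) =
        brk A (brk B C) x := by
    intro A B C hA hB hC
    have h1 : ∀ᶠ y in 𝓝 x, brk B C y = (nab cov B C - nab cov C B) y := by
      filter_upwards [hB.eventually, hC.eventually] with y h1 h2
      exact hcov.torsion h1.mdiff h2.mdiff
    have h2 := (hB.nab hcov hC)
    have h3 := (hC.nab hcov hB)
    rw [hcov.torsion hA.mdiff (hB.brk hC).mdiff, cov_congr (hB.brk hC).mdiff (h2.sub h3).mdiff h1,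
      cov_sub h2.mdiff h3.mdiff]
  have j := jacobi hX.self hY.self hZ.self
  have e1 := key X Y Z hX hY hZ
  have e2 := key Y Z X hY hZ hX
  have e3 := key Z X Y hZ hX hY
  have s1 : brk Y (brk Z X) x = - brk Y (brk X Z) x := by
    rw [brk_swap Y (brk Z X), brk_swap Y (brk X Z)]
    rw [brk, brk, mlieBracket_swap (V := Z) (W := X), ← neg_one_smul ℝ (mlieBracket (𝓡 4) X Z),
      mlieBracket_const_smul_left (hX.brk hZ).mdiff]
    simp
  have s2 := brk_swap Z (brk X Y) x
  have : curvatureField cov X Y Z x + curvatureField cov Y Z X x + curvatureField cov Z X Y x =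
      brk X (brk Y Z) x + brk Y (brk Z X) x + brk Z (brk X Y) x := by
    rw [← e1, ← e2, ← e3]
    simp only [KahlerSurface.curvatureField]
    abel
  rw [this, j, s1, s2]
  abel

/-- The octahedron argument: four cyclic identities combined with skewness in each pair of slots. -/
lemma inner_curvatureField_pair (hcov : IsLeviCivita cov) (hX : SmoothNear X x)
    (hY : SmoothNear Y x) (hZ : SmoothNear Z x) (hW : SmoothNear W x) :
    ⟪curvatureField cov X Y Z x, W x⟫_ℝ = ⟪curvatureField cov Z W X x, Y x⟫_ℝ := by
  have b : ∀ A B C D : TangentField M, SmoothNear A x → SmoothNear B x → SmoothNear C x →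
      ⟪curvatureField cov A B C x, D x⟫_ℝ + ⟪curvatureField cov B C A x, D x⟫_ℝ +
        ⟪curvatureField cov C A B x, D x⟫_ℝ = 0 := by
    intro A B C D hA hB hC
    rw [← inner_add_left, ← inner_add_left, first_bianchi hcov hA hB hC, inner_zero_left]
  have s : ∀ A B C D : TangentField M,
      ⟪curvatureField cov A B C x, D x⟫_ℝ = - ⟪curvatureField cov B A C x, D x⟫_ℝ := by
    intro A B C D
    rw [curvatureField_swap, inner_neg_left]
  have b1 := b X Y Z W hX hY hZ
  have b2 := b Y Z W X hY hZ hW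
  have b3 := b Z W X Y hZ hW hX
  have b4 := b W X Y Z hW hX hY
  have k1 := inner_curvatureField_skew hcov hX hY hZ hW
  have k2 := inner_curvatureField_skew hcov hY hZ hX hW
  have k3 := inner_curvatureField_skew hcov hZ hX hY hW
  have k4 := inner_curvatureField_skew hcov hW hX hZ hY
  have k5 := inner_curvatureField_skew hcov hW hY hX hZ
  have k6 := inner_curvatureField_skew hcov hZ hW hX hY
  have s1 := s Y W Z X
  have s2 := s W Z X Y
  have s3 := s W X Z Y
  have s4 := s X W Z Y
  have s5 := s Z X Y W
  have s6 := s Y W X Z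
  have s7 := s X Z W Y
  have s8 := s W Z Y X
  have s9 := s Z X W Y
  have k7 := inner_curvatureField_skew hcov hX hZ hW hY
  linarith

/-- The curvature field at a point only depends on the values of the vector fields there. -/
lemma curvatureField_eq (hcov : IsLeviCivita cov) (hX : SmoothNear X x)
    (hY : SmoothNear Y x) (hZ : SmoothNear Z x) :
    curvatureField cov X Y Z x = curvature cov x (X x) (Y x) (Z x) := by
  -- Tensoriality is read off from the symmetries. Skewness moves the third field into an inner
  -- product, where only its value at `x` counts; pair symmetry then brings the first slot to the
  -- third.
  have third : ∀ A B C C' : TangentField M, SmoothNear A x → SmoothNear B x → SmoothNear C x →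
      SmoothNear C' x → C x = C' x → curvatureField cov A B C x = curvatureField cov A B C' x := by
    intro A B C C' hA hB hC hC' h
    refine ext_inner_right ℝ fun v ↦ ?_
    have hv := smoothNear_extend v
    have e := FiberBundle.extend_apply_self (F := E4) v
    rw [← e, inner_curvatureField_skew hcov hA hB hC hv,
      inner_curvatureField_skew hcov hA hB hC' hv, h]
  have first : ∀ A A' B C : TangentField M, SmoothNear A x → SmoothNear A' x → SmoothNear B x →
      SmoothNear C x → A x = A' x → curvatureField cov A B C x = curvatureField cov A' B C x := by
    intro A A' B C hA hA' hB hC h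
    refine ext_inner_right ℝ fun v ↦ ?_
    have hv := smoothNear_extend v
    have e := FiberBundle.extend_apply_self (F := E4) v
    rw [← e, inner_curvatureField_pair hcov hA hB hC hv,
      inner_curvatureField_pair hcov hA' hB hC hv, third _ _ _ _ hC hv hA hA' h]
  have eX := smoothNear_extend (X x)
  have eY := smoothNear_extend (Y x)
  have eZ := smoothNear_extend (Z x)
  rw [curvature, third _ _ _ _ hX hY hZ eZ (by simp), first _ _ _ _ hX eX hY eZ (by simp),
    curvatureField_swap, first _ _ _ _ hY eY eX eZ (by simp), ← curvatureField_swap]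

variable {u u' v v' w w' z : TangentSpace (𝓡 4) x}

lemma curvature_swap (cov : Connection M) (u v w : TangentSpace (𝓡 4) x) :
    curvature cov x u v w = - curvature cov x v u w := curvatureField_swap _ _ _ _

lemma inner_curvature_skew (hcov : IsLeviCivita cov) :
    ⟪curvature cov x u v w, z⟫_ℝ = - ⟪curvature cov x u v z, w⟫_ℝ := by
  simpa [curvature] using inner_curvatureField_skew hcov (smoothNear_extend u) (smoothNear_extend v)
    (smoothNear_extend w) (smoothNear_extend z)

lemma inner_curvature_pair (hcov : IsLeviCivita cov) :
    ⟪curvature cov x u v w, z⟫_ℝ = ⟪curvature cov x w z u, v⟫_ℝ := by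
  simpa [curvature] using inner_curvatureField_pair hcov (smoothNear_extend u) (smoothNear_extend v)
    (smoothNear_extend w) (smoothNear_extend z)

lemma curvature_add_right (hcov : IsLeviCivita cov) :
    curvature cov x u v (w + w') = curvature cov x u v w + curvature cov x u v w' := by
  refine ext_inner_right ℝ fun z ↦ ?_
  simp only [inner_add_left, inner_curvature_skew hcov (z := z), inner_add_right]
  ring

lemma curvature_smul_right (hcov : IsLeviCivita cov) (t : ℝ) :
    curvature cov x u v (t • w) = t • curvature cov x u v w := by
  refine ext_inner_right ℝ fun z ↦ ?_
  simp only [real_inner_smul_left, inner_curvature_skew hcov (z := z), inner_smul_right]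
  simp

lemma curvature_add_left (hcov : IsLeviCivita cov) :
    curvature cov x (u + u') v w = curvature cov x u v w + curvature cov x u' v w := by
  refine ext_inner_right ℝ fun z ↦ ?_
  simp only [inner_add_left, inner_curvature_pair hcov (z := z), curvature_add_right hcov]

lemma curvature_smul_left (hcov : IsLeviCivita cov) (t : ℝ) :
    curvature cov x (t • u) v w = t • curvature cov x u v w := by
  refine ext_inner_right ℝ fun z ↦ ?_
  simp only [real_inner_smul_left, inner_curvature_pair hcov (z := z), curvature_smul_right hcov]

lemma curvature_add_mid (hcov : IsLeviCivita cov) :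
    curvature cov x u (v + v') w = curvature cov x u v w + curvature cov x u v' w := by
  rw [curvature_swap, curvature_add_left hcov, curvature_swap cov u v, curvature_swap cov u v',
    neg_add]

lemma curvature_smul_mid (hcov : IsLeviCivita cov) (t : ℝ) :
    curvature cov x u (t • v) w = t • curvature cov x u v w := by
  rw [curvature_swap, curvature_smul_left hcov, curvature_swap cov u v, smul_neg]

/-- This is the Jacobi identity for the operators `∇_X`, `∇_Y`, `∇_Z` acting on `W`. The bracket
terms replace the derivatives of the first two arguments of `R`, so no covariant derivative of a
tensor is needed. -/
lemma second_bianchi (hcov : IsLeviCivita cov) (hX : SmoothNear X x)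
    (hY : SmoothNear Y x) (hZ : SmoothNear Z x) (hW : SmoothNear W x) :
    (cov (curvatureField cov Y Z W) x (X x) - curvatureField cov Y Z (nab cov X W) x
        - curvatureField cov (brk X Y) Z W x)
      + (cov (curvatureField cov Z X W) x (Y x) - curvatureField cov Z X (nab cov Y W) x
        - curvatureField cov (brk Y Z) X W x)
      + (cov (curvatureField cov X Y W) x (Z x) - curvatureField cov X Y (nab cov Z W) x
        - curvatureField cov (brk Z X) Y W x) = 0 := by
  have key : ∀ A B C : TangentField M, SmoothNear A x → SmoothNear B x → SmoothNear C x →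
      cov (curvatureField cov B C W) x (A x) = cov (nab cov B (nab cov C W)) x (A x)
        - cov (nab cov C (nab cov B W)) x (A x) - cov (nab cov (brk B C) W) x (A x) := by
    intro A B C hA hB hC
    have h1 := hB.nab hcov (hC.nab hcov hW)
    have h2 := hC.nab hcov (hB.nab hcov hW)
    have h3 := (hB.brk hC).nab hcov hW
    rw [← cov_sub h1.mdiff h2.mdiff, ← cov_sub (h1.sub h2).mdiff h3.mdiff]
    rfl
  have j := jacobi hX.self hY.self hZ.self
  have s1 : brk (brk Z X) Y x = brk Y (brk X Z) x := by
    rw [brk_swap Y (brk X Z)]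
    rw [brk, brk, mlieBracket_swap (V := Z) (W := X), ← neg_one_smul ℝ (mlieBracket (𝓡 4) X Z),
      mlieBracket_const_smul_left (hX.brk hZ).mdiff]
    simp
  have s2 := brk_swap X (brk Y Z) x
  have hj : cov W x (brk (brk X Y) Z x) + cov W x (brk (brk Y Z) X x)
      + cov W x (brk (brk Z X) Y x) = 0 := by
    rw [← map_add, ← map_add, s1, ← neg_neg (brk (brk Y Z) X x), ← s2, j]
    simp
  rw [key X Y Z hX hY hZ, key Y Z X hY hZ hX, key Z X Y hZ hX hY]
  simp only [KahlerSurface.curvatureField]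
  rw [← hj]
  abel

variable {J : EndField M}

lemma SmoothFieldAt.mapJ (hJ : IsKahler cov J) (hX : SmoothFieldAt X x) :
    SmoothFieldAt (fun y ↦ J y (X y)) x :=
  ContMDiffAt.clm_bundle_apply (hJ.smooth x) hX

lemma SmoothNear.mapJ (hJ : IsKahler cov J) (hX : SmoothNear X x) :
    SmoothNear (fun y ↦ J y (X y)) x := by
  filter_upwards [hX] with y h using SmoothFieldAt.mapJ hJ h

lemma curvatureField_J (hcov : IsLeviCivita cov) (hJ : IsKahler cov J) (hX : SmoothNear X x)
    (hY : SmoothNear Y x) (hZ : SmoothNear Z x) :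
    curvatureField cov X Y (fun y ↦ J y (Z y)) x = J x (curvatureField cov X Y Z x) := by
  have key : ∀ A B : TangentField M, SmoothNear A x → SmoothNear B x →
      cov (nab cov B (fun y ↦ J y (Z y))) x (A x) = J x (cov (nab cov B Z) x (A x)) := by
    intro A B hA hB
    have h1 : ∀ᶠ y in 𝓝 x, nab cov B (fun y ↦ J y (Z y)) y = J y (nab cov B Z y) := by
      filter_upwards [hZ] with y h using hJ.parallel y Z h _
    rw [cov_congr (hB.nab hcov (hZ.mapJ hJ)).mdiff ((hB.nab hcov hZ).mapJ hJ).mdiff h1]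
    exact hJ.parallel x _ (hB.nab hcov hZ).self _
  simp only [KahlerSurface.curvatureField, map_sub]
  rw [← key X Y hX hY, ← key Y X hY hX, hJ.parallel x Z hZ.self]

lemma curvature_J (hcov : IsLeviCivita cov) (hJ : IsKahler cov J) :
    curvature cov x u v (J x w) = J x (curvature cov x u v w) := by
  have h := curvatureField_J hcov hJ (smoothNear_extend u) (smoothNear_extend v)
    (smoothNear_extend w)
  rw [curvatureField_eq hcov (smoothNear_extend u) (smoothNear_extend v)
    ((smoothNear_extend w).mapJ hJ)] at h
  simpa using! h

end Curvature

/-! ### Linear algebra of the curvature at one point. -/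

section Pointwise

variable {M : Type*} [TopologicalSpace M] [ChartedSpace E4 M] [IsManifold (𝓡 4) ∞ M]
  {cov : Connection M} {x : M}
  [RiemannianBundle (fun x : M ↦ TangentSpace (𝓡 4) x)]
  [IsContMDiffRiemannianBundle (𝓡 4) ∞ E4 (fun x : M ↦ TangentSpace (𝓡 4) x)]

lemma finrank_tangentSpace (x : M) : Module.finrank ℝ (TangentSpace (𝓡 4) x) = 4 := by
  have : Module.finrank ℝ E4 = 4 := by simp
  exact this

lemma mem_nullity_iff (hcov : IsLeviCivita cov) {w : TangentSpace (𝓡 4) x} :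
    w ∈ nullity cov x ↔ ∀ u v : TangentSpace (𝓡 4) x, curvature cov x u v w = 0 := by
  refine ⟨fun h u v ↦ ?_, fun h ↦ Submodule.subset_span h⟩
  induction h using Submodule.span_induction with
  | mem w h => exact h u v
  | zero => simpa using curvature_smul_right (u := u) (v := v) (w := 0) hcov 0
  | add a b _ _ ha hb => rw [curvature_add_right hcov, ha, hb, add_zero]
  | smul t a _ ha => rw [curvature_smul_right hcov, ha, smul_zero]

lemma curvature_eq_zero_of_left (hcov : IsLeviCivita cov) {u : TangentSpace (𝓡 4) x}
    (h : u ∈ nullity cov x) (v w : TangentSpace (𝓡 4) x) : curvature cov x u v w = 0 := by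
  refine ext_inner_right ℝ fun z ↦ ?_
  rw [inner_curvature_pair hcov, (mem_nullity_iff hcov).1 h]
  simp

lemma curvature_mem_nullity_orthogonal (hcov : IsLeviCivita cov) (u v w : TangentSpace (𝓡 4) x) :
    curvature cov x u v w ∈ (nullity cov x)ᗮ := by
  rw [Submodule.mem_orthogonal']
  intro z hz
  rw [inner_curvature_skew hcov, (mem_nullity_iff hcov).1 hz]
  simp

variable {J : EndField M}

lemma IsKahler.inner_right (hJ : IsKahler cov J) (v w : TangentSpace (𝓡 4) x) :
    ⟪v, J x w⟫_ℝ = - ⟪J x v, w⟫_ℝ := by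
  rw [← hJ.orthogonal x v (J x w), hJ.sq]
  simp

lemma IsKahler.inner_self (hJ : IsKahler cov J) (v : TangentSpace (𝓡 4) x) :
    ⟪v, J x v⟫_ℝ = 0 := by
  have := hJ.inner_right v v
  rw [real_inner_comm v] at this
  linarith

lemma IsKahler.mem_nullity (hcov : IsLeviCivita cov) (hJ : IsKahler cov J)
    {w : TangentSpace (𝓡 4) x} (hw : w ∈ nullity cov x) : J x w ∈ nullity cov x := by
  rw [mem_nullity_iff hcov] at hw ⊢
  intro u v
  rw [curvature_J hcov hJ, hw, map_zero]

lemma IsKahler.mem_nullity_orthogonal (hcov : IsLeviCivita cov) (hJ : IsKahler cov J)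
    {w : TangentSpace (𝓡 4) x} (hw : w ∈ (nullity cov x)ᗮ) : J x w ∈ (nullity cov x)ᗮ := by
  rw [Submodule.mem_orthogonal] at hw ⊢
  intro u hu
  rw [hJ.inner_right, hw _ (hJ.mem_nullity hcov hu), neg_zero]

/-- A unitary frame of the tangent space at `x` whose last two vectors span the nullity. -/
structure IsAdaptedBasis (cov : Connection M) (J : EndField M) (x : M)
    (e : Fin 4 → TangentSpace (𝓡 4) x) : Prop where
  orthonormal : Orthonormal ℝ e
  J_zero : J x (e 0) = e 1
  J_two : J x (e 2) = e 3
  mem_two : e 2 ∈ nullity cov x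
  mem_three : e 3 ∈ nullity cov x

namespace IsAdaptedBasis

variable {e : Fin 4 → TangentSpace (𝓡 4) x} (he : IsAdaptedBasis cov J x e)

include he

lemma inner_eq (i j : Fin 4) : ⟪e i, e j⟫_ℝ = if i = j then 1 else 0 :=
  orthonormal_iff_ite.1 he.orthonormal i j

/-- The orthonormal basis given by an adapted frame. -/
noncomputable def basis : OrthonormalBasis (Fin 4) ℝ (TangentSpace (𝓡 4) x) :=
  (basisOfOrthonormalOfCardEqFinrank he.orthonormal (by simp [finrank_tangentSpace])).toOrthonormalBasis
    (by simpa using he.orthonormal)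

lemma basis_apply (i : Fin 4) : he.basis i = e i := by simp [basis]

lemma sum_eq (v : TangentSpace (𝓡 4) x) :
    v = ⟪e 0, v⟫_ℝ • e 0 + ⟪e 1, v⟫_ℝ • e 1 + ⟪e 2, v⟫_ℝ • e 2 + ⟪e 3, v⟫_ℝ • e 3 := by
  have := (he.basis.sum_repr' v).symm
  simpa [Fin.sum_univ_four, basis_apply] using this

lemma J_one (hJ : IsKahler cov J) : J x (e 1) = - e 0 := by rw [← he.J_zero, hJ.sq]

lemma J_three (hJ : IsKahler cov J) : J x (e 3) = - e 2 := by rw [← he.J_two, hJ.sq]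

lemma curvature_zero_one_one (hcov : IsLeviCivita cov) :
    curvature cov x (e 0) (e 1) (e 1) = ⟪curvature cov x (e 0) (e 1) (e 1), e 0⟫_ℝ • e 0 := by
  have h1 : ⟪e 1, curvature cov x (e 0) (e 1) (e 1)⟫_ℝ = 0 := by
    have := inner_curvature_skew (u := e 0) (v := e 1) (w := e 1) (z := e 1) hcov
    rw [real_inner_comm]
    linarith
  have h2 : ∀ z ∈ nullity cov x, ⟪z, curvature cov x (e 0) (e 1) (e 1)⟫_ℝ = 0 :=
    (Submodule.mem_orthogonal _ _).1 (curvature_mem_nullity_orthogonal hcov _ _ _)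
  conv_lhs => rw [he.sum_eq (curvature cov x (e 0) (e 1) (e 1)), h1, h2 _ he.mem_two,
    h2 _ he.mem_three, real_inner_comm]
  simp

/-- The nullity drops out of every slot, so only `R(e₀, e₁)` on `span {e₀, e₁}` survives. There
`R(e₀, e₁)e₁` is a multiple of `e₀`, and commutation with `J` determines `R(e₀, e₁)e₀`. -/
lemma curvature_eq (hcov : IsLeviCivita cov) (hJ : IsKahler cov J)
    (u v w : TangentSpace (𝓡 4) x) :
    curvature cov x u v w = (⟪curvature cov x (e 0) (e 1) (e 1), e 0⟫_ℝ *
      (⟪e 0, u⟫_ℝ * ⟪e 1, v⟫_ℝ - ⟪e 1, u⟫_ℝ * ⟪e 0, v⟫_ℝ)) •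
        (⟪e 1, w⟫_ℝ • e 0 - ⟪e 0, w⟫_ℝ • e 1) := by
  have h11 := he.curvature_zero_one_one hcov
  set c := ⟪curvature cov x (e 0) (e 1) (e 1), e 0⟫_ℝ
  have h10 : curvature cov x (e 0) (e 1) (e 0) = - c • e 1 := by
    have h := curvature_J (u := e 0) (v := e 1) (w := e 1) hcov hJ
    rw [h11, he.J_one hJ, map_smul, he.J_zero, ← neg_one_smul ℝ (e 0),
      curvature_smul_right hcov] at h
    rw [neg_smul, ← h]
    simp
  have hz : ∀ t : TangentSpace (𝓡 4) x, curvature cov x t t w = 0 := by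
    intro t
    have h : (2 : ℝ) • curvature cov x t t w = 0 := by
      rw [two_smul]
      nth_rewrite 2 [curvature_swap]
      exact add_neg_cancel _
    simpa using h
  have hn := fun (a b t : TangentSpace (𝓡 4) x) (ht : t ∈ nullity cov x) ↦
    (mem_nullity_iff hcov).1 ht a b
  have h01 : curvature cov x (e 0) (e 1) w = c • (⟪e 1, w⟫_ℝ • e 0 - ⟪e 0, w⟫_ℝ • e 1) := by
    conv_lhs => rw [he.sum_eq w]
    simp only [curvature_add_right hcov, curvature_smul_right hcov, h10, h11,
      hn _ _ _ he.mem_two, hn _ _ _ he.mem_three]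
    module
  have hl := fun (a b t : TangentSpace (𝓡 4) x) (ht : t ∈ nullity cov x) ↦
    curvature_eq_zero_of_left hcov ht a b
  have hm : ∀ (a b t : TangentSpace (𝓡 4) x), t ∈ nullity cov x → curvature cov x a t b = 0 := by
    intro a b t ht
    rw [curvature_swap, hl _ _ _ ht, neg_zero]
  conv_lhs => rw [he.sum_eq u, he.sum_eq v]
  simp only [curvature_add_left hcov, curvature_add_mid hcov, curvature_smul_left hcov,
    curvature_smul_mid hcov, hl _ _ _ he.mem_two, hl _ _ _ he.mem_three, hm _ _ _ he.mem_two,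
    hm _ _ _ he.mem_three, hz, curvature_swap cov (e 1) (e 0) w, h01]
  module

lemma scalarCurvature_eq (hcov : IsLeviCivita cov) (hJ : IsKahler cov J) :
    scalarCurvature cov x = 2 * ⟪curvature cov x (e 0) (e 1) (e 1), e 0⟫_ℝ := by
  simp only [scalarCurvature]
  set f := stdOrthonormalBasis ℝ (TangentSpace (𝓡 4) x)
  -- Parseval makes the double sum over the standard orthonormal basis independent of that basis.
  have hf : ∀ i j : Fin 4, ∑ k, ⟪e i, f k⟫_ℝ * ⟪e j, f k⟫_ℝ = if i = j then 1 else 0 := by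
    intro i j
    rw [← he.inner_eq, ← f.sum_inner_mul_inner]
    simp [real_inner_comm]
  simp only [he.curvature_eq hcov hJ _ _ (f _)]
  set c := ⟪curvature cov x (e 0) (e 1) (e 1), e 0⟫_ℝ
  have h : ∀ i j, ⟪(c * (⟪e 0, f i⟫_ℝ * ⟪e 1, f j⟫_ℝ - ⟪e 1, f i⟫_ℝ * ⟪e 0, f j⟫_ℝ)) •
      (⟪e 1, f j⟫_ℝ • e 0 - ⟪e 0, f j⟫_ℝ • e 1), f i⟫_ℝ =
      c * ((⟪e 0, f i⟫_ℝ * ⟪e 0, f i⟫_ℝ) * (⟪e 1, f j⟫_ℝ * ⟪e 1, f j⟫_ℝ)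
        - 2 * ((⟪e 0, f i⟫_ℝ * ⟪e 1, f i⟫_ℝ) * (⟪e 0, f j⟫_ℝ * ⟪e 1, f j⟫_ℝ))
        + (⟪e 1, f i⟫_ℝ * ⟪e 1, f i⟫_ℝ) * (⟪e 0, f j⟫_ℝ * ⟪e 0, f j⟫_ℝ)) := by
    intro i j
    simp only [real_inner_smul_left, inner_sub_left]
    ring
  simp only [h, ← Finset.mul_sum, Finset.sum_add_distrib, Finset.sum_sub_distrib,
    ← Finset.sum_mul, hf]
  norm_num
  ring

lemma nullity_eq_span (hD : Module.finrank ℝ (nullity cov x) = 2) :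
    nullity cov x = Submodule.span ℝ {e 2, e 3} := by
  symm
  apply Submodule.eq_of_le_of_finrank_eq
  · rw [Submodule.span_le]
    rintro v (rfl | rfl)
    exacts [he.mem_two, he.mem_three]
  · rw [hD]
    have h := finrank_span_eq_card (he.orthonormal.linearIndependent.comp ![2, 3] (by decide))
    have hr : Set.range (e ∘ ![2, 3]) = {e 2, e 3} := by
      ext v
      simp [eq_comm]
    rw [← hr, h, Fintype.card_fin]

lemma zero_mem (hD : Module.finrank ℝ (nullity cov x) = 2) : e 0 ∈ (nullity cov x)ᗮ := by
  rw [he.nullity_eq_span hD, Submodule.mem_orthogonal]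
  intro w hw
  obtain ⟨a, b, rfl⟩ := Submodule.mem_span_pair.1 hw
  simp [inner_add_left, real_inner_smul_left, he.inner_eq]

lemma starProjection_eq (hD : Module.finrank ℝ (nullity cov x) = 2) (v : TangentSpace (𝓡 4) x) :
    (nullity cov x).starProjection v = ⟪e 2, v⟫_ℝ • e 2 + ⟪e 3, v⟫_ℝ • e 3 := by
  apply Submodule.eq_starProjection_of_mem_of_inner_eq_zero
  · exact add_mem (Submodule.smul_mem _ _ he.mem_two) (Submodule.smul_mem _ _ he.mem_three)
  · intro w hw
    rw [he.nullity_eq_span hD, Submodule.mem_span_pair] at hw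
    obtain ⟨a, b, rfl⟩ := hw
    simp only [inner_sub_left, inner_add_left, inner_add_right, real_inner_smul_left,
      real_inner_smul_right, he.inner_eq, real_inner_comm v]
    simp

lemma starProjection_orthogonal_eq (hD : Module.finrank ℝ (nullity cov x) = 2)
    (v : TangentSpace (𝓡 4) x) :
    (nullity cov x)ᗮ.starProjection v = ⟪e 0, v⟫_ℝ • e 0 + ⟪e 1, v⟫_ℝ • e 1 := by
  rw [Submodule.starProjection_orthogonal_val, he.starProjection_eq hD, sub_eq_iff_eq_add]
  conv_lhs => rw [he.sum_eq v]
  abel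

/-- If this coefficient were zero, then `R = 0` and the nullity would have rank 4. Hence `c`
vanishes nowhere. -/
lemma curvature_ne_zero (hcov : IsLeviCivita cov) (hJ : IsKahler cov J)
    (hD : Module.finrank ℝ (nullity cov x) = 2) :
    ⟪curvature cov x (e 0) (e 1) (e 1), e 0⟫_ℝ ≠ 0 := by
  intro h
  have : nullity cov x = ⊤ := by
    rw [eq_top_iff]
    intro w _
    rw [mem_nullity_iff hcov]
    intro u v
    rw [he.curvature_eq hcov hJ, h]
    simp
  rw [this, finrank_top, finrank_tangentSpace] at hD
  omega

end IsAdaptedBasis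

end Pointwise

/-! ### Existence of smooth adapted frames and their connection forms. -/

section Frame

variable {M : Type*} [TopologicalSpace M] [ChartedSpace E4 M] [IsManifold (𝓡 4) ∞ M]
  {cov : Connection M} {x : M}
  [RiemannianBundle (fun x : M ↦ TangentSpace (𝓡 4) x)]
  [IsContMDiffRiemannianBundle (𝓡 4) ∞ E4 (fun x : M ↦ TangentSpace (𝓡 4) x)]
  {J : EndField M}

lemma SmoothNear.exists_normalized {X : TangentField M} (hX : SmoothNear X x) (h0 : X x ≠ 0) :
    ∃ e : TangentField M, SmoothNear e x ∧ ∀ᶠ y in 𝓝 x, ⟪e y, e y⟫_ℝ = 1 ∧ ∃ t : ℝ, e y = t • X y := by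
  have hn := hX.inner hX
  have hpos : 0 < ⟪X x, X x⟫_ℝ := real_inner_self_pos.2 h0
  have hpos' : ∀ᶠ y in 𝓝 x, 0 < ⟪X y, X y⟫_ℝ :=
    hn.self.continuousAt.eventually (lt_mem_nhds hpos)
  have hf : FnSmoothNear (fun y ↦ (fun t : ℝ ↦ (√t)⁻¹) ⟪X y, X y⟫_ℝ) x := by
    refine hn.comp (g := fun t : ℝ ↦ (√t)⁻¹) ?_
    filter_upwards [lt_mem_nhds hpos] with t ht
    exact (Real.contDiffAt_sqrt ht.ne').inv (Real.sqrt_pos.2 ht).ne'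
  refine ⟨_, hf.smul hX, ?_⟩
  filter_upwards [hpos'] with y hy
  refine ⟨?_, _, rfl⟩
  change ⟪(√⟪X y, X y⟫_ℝ)⁻¹ • X y, (√⟪X y, X y⟫_ℝ)⁻¹ • X y⟫_ℝ = 1
  rw [real_inner_smul_left, real_inner_smul_right]
  have := Real.mul_self_sqrt hy.le
  have h2 := (Real.sqrt_pos.2 hy).ne'
  field_simp
  linarith

/-- A smooth unitary frame on the open set `U` whose last two fields span the nullity. -/
structure IsAdaptedFrame (cov : Connection M) (J : EndField M) (U : Set M)
    (e : Fin 4 → TangentField M) : Prop where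
  isOpen : IsOpen U
  smooth : ∀ i, ∀ y ∈ U, SmoothFieldAt (e i) y
  basis : ∀ y ∈ U, IsAdaptedBasis cov J y (fun i ↦ e i y)

lemma norm_eq_one_of_inner_self {z : TangentSpace (𝓡 4) x} (hz : ⟪z, z⟫_ℝ = 1) : ‖z‖ = 1 :=
  (sq_eq_sq₀ (norm_nonneg z) zero_le_one).1 (by rw [← real_inner_self_eq_norm_sq, hz, one_pow])

lemma exists_curvature_ne_zero (hcov : IsLeviCivita cov)
    (hD : Module.finrank ℝ (nullity cov x) = 2) :
    ∃ u v w : TangentSpace (𝓡 4) x, curvature cov x u v w ≠ 0 := by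
  by_contra! h
  have : nullity cov x = ⊤ := by
    rw [eq_top_iff]
    intro w _
    rw [mem_nullity_iff hcov]
    exact fun u v ↦ h u v w
  rw [this, finrank_top, finrank_tangentSpace] at hD
  omega

lemma mem_nullity_of_inner_eq_zero (hD : Module.finrank ℝ (nullity cov x) = 2)
    {a b w : TangentSpace (𝓡 4) x} (ha : a ∈ (nullity cov x)ᗮ) (hb : b ∈ (nullity cov x)ᗮ)
    (haa : ⟪a, a⟫_ℝ = 1) (hbb : ⟪b, b⟫_ℝ = 1) (hab : ⟪a, b⟫_ℝ = 0)
    (hwa : ⟪a, w⟫_ℝ = 0) (hwb : ⟪b, w⟫_ℝ = 0) : w ∈ nullity cov x := by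
  have hba : ⟪b, a⟫_ℝ = 0 := by rw [real_inner_comm, hab]
  have ho : Orthonormal ℝ ![a, b] := by
    refine ⟨fun i ↦ ?_, fun i j hij ↦ ?_⟩
    · fin_cases i
      exacts [norm_eq_one_of_inner_self haa, norm_eq_one_of_inner_self hbb]
    · fin_cases i <;> fin_cases j
      exacts [absurd rfl hij, hab, hba, absurd rfl hij]
  have hfin : Module.finrank ℝ ((nullity cov x)ᗮ : Submodule ℝ (TangentSpace (𝓡 4) x)) = 2 := by
    have := Submodule.finrank_add_finrank_orthogonal (nullity cov x)
    rw [finrank_tangentSpace, hD] at this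
    omega
  have hs : Submodule.span ℝ (Set.range ![a, b]) = (nullity cov x)ᗮ := by
    apply Submodule.eq_of_le_of_finrank_eq
    · rw [Submodule.span_le]
      rintro _ ⟨i, rfl⟩
      fin_cases i
      exacts [ha, hb]
    · rw [hfin, finrank_span_eq_card ho.linearIndependent, Fintype.card_fin]
  rw [← Submodule.orthogonal_orthogonal (nullity cov x), ← hs, Submodule.mem_orthogonal]
  intro u hu
  have hr : Set.range ![a, b] = {a, b} := by
    ext v
    simp [eq_comm, or_comm]
  rw [hr] at hu
  obtain ⟨s, t, rfl⟩ := Submodule.mem_span_pair.1 hu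
  rw [inner_add_left, real_inner_smul_left, real_inner_smul_left, hwa, hwb]
  simp

/-- Smoothness of `D` is not assumed but produced. Values of `R` lie in `Dᗮ`, so a nonvanishing
smooth field `R(u, v)w` and its image under `J` span `Dᗮ` near `p`; what is orthogonal to both lies
in `D` because the rank is 2. -/
lemma exists_adaptedFrame (hcov : IsLeviCivita cov) (hJ : IsKahler cov J)
    (hD : ∀ x : M, Module.finrank ℝ (nullity cov x) = 2) (p : M) :
    ∃ U e, p ∈ U ∧ IsAdaptedFrame cov J U e := by
  obtain ⟨u, v, w, hne⟩ := exists_curvature_ne_zero hcov (hD p)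
  have hu := smoothNear_extend u
  have hv := smoothNear_extend v
  have hw := smoothNear_extend w
  obtain ⟨a, ha, ha'⟩ := (SmoothNear.curvatureField hcov hu hv hw).exists_normalized hne
  have hb := ha.mapJ hJ
  set b : TangentField M := fun y ↦ J y (a y)
  have haE : ∀ᶠ y in 𝓝 p, a y ∈ (nullity cov y)ᗮ := by
    filter_upwards [ha', hu.eventually, hv.eventually, hw.eventually] with y h1 h2 h3 h4
    obtain ⟨-, t, ht⟩ := h1
    rw [ht, curvatureField_eq hcov h2 h3 h4]
    exact Submodule.smul_mem _ _ (curvature_mem_nullity_orthogonal hcov _ _ _)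
  obtain ⟨w₀, hw₀, hw₀ne⟩ : ∃ w₀ ∈ nullity cov p, w₀ ≠ 0 := by
    refine (Submodule.ne_bot_iff _).1 fun h ↦ ?_
    have := hD p
    rw [h, finrank_bot] at this
    omega
  have hW := smoothNear_extend w₀
  set W := FiberBundle.extend E4 w₀ with hWdef
  -- `V` is the `D`-component of `W` near `p`. It equals `w₀` at `p`, so it can be normalized there.
  set V : TangentField M := W - (fun y ↦ ⟪a y, W y⟫_ℝ) • a - (fun y ↦ ⟪b y, W y⟫_ℝ) • b with hVdef
  have hV : SmoothNear V p := (hW.sub ((ha.inner hW).smul ha)).sub ((hb.inner hW).smul hb)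
  have hVy : ∀ y, V y = W y - ⟪a y, W y⟫_ℝ • a y - ⟪b y, W y⟫_ℝ • b y := fun y ↦ rfl
  have hVp : V p = w₀ := by
    have h1 := haE.self_of_nhds
    have h2 := hJ.mem_nullity_orthogonal hcov h1
    rw [hVy, hWdef, FiberBundle.extend_apply_self, (Submodule.mem_orthogonal' _ _).1 h1 _ hw₀,
      (Submodule.mem_orthogonal' _ _).1 h2 _ hw₀]
    simp
  obtain ⟨d, hd, hd'⟩ := hV.exists_normalized (by rwa [hVp])
  have hn : ∀ᶠ y in 𝓝 p, IsAdaptedBasis cov J y (fun i ↦ ![a, b, d, fun y ↦ J y (d y)] i y) := by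
    filter_upwards [ha', haE, hd'] with y h1 h2 h3
    obtain ⟨haa, -⟩ := h1
    obtain ⟨hdd, t, ht⟩ := h3
    have hab : ⟪a y, b y⟫_ℝ = 0 := hJ.inner_self _
    have hbb : ⟪b y, b y⟫_ℝ = 1 := by rw [← haa]; exact hJ.orthogonal _ _ _
    have hbE : b y ∈ (nullity cov y)ᗮ := hJ.mem_nullity_orthogonal hcov h2
    have hdN : d y ∈ nullity cov y := by
      rw [ht]
      refine Submodule.smul_mem _ _ (mem_nullity_of_inner_eq_zero (hD y) h2 hbE haa hbb hab ?_ ?_)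
      · rw [hVy, inner_sub_right, inner_sub_right, real_inner_smul_right, real_inner_smul_right,
          haa, hab]
        ring
      · rw [hVy, inner_sub_right, inner_sub_right, real_inner_smul_right, real_inner_smul_right,
          hbb, real_inner_comm (a y), hab]
        ring
    have hcN : J y (d y) ∈ nullity cov y := hJ.mem_nullity hcov hdN
    refine ⟨?_, rfl, rfl, hdN, hcN⟩
    have had := (Submodule.mem_orthogonal' _ _).1 h2 _ hdN
    have hac := (Submodule.mem_orthogonal' _ _).1 h2 _ hcN
    have hbd := (Submodule.mem_orthogonal' _ _).1 hbE _ hdN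
    have hbc := (Submodule.mem_orthogonal' _ _).1 hbE _ hcN
    have hdc : ⟪d y, J y (d y)⟫_ℝ = 0 := hJ.inner_self _
    have hcc : ⟪J y (d y), J y (d y)⟫_ℝ = 1 := by rw [hJ.orthogonal, hdd]
    refine ⟨?_, ?_⟩
    · intro i
      fin_cases i
      exacts [norm_eq_one_of_inner_self haa, norm_eq_one_of_inner_self hbb, norm_eq_one_of_inner_self hdd, norm_eq_one_of_inner_self hcc]
    · intro i j hij
      fin_cases i <;> fin_cases j <;>
        first
        | exact absurd rfl hij
        | assumption
        | (rw [real_inner_comm]; assumption)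
  have hsm : ∀ᶠ y in 𝓝 p, ∀ i, SmoothFieldAt (![a, b, d, fun y ↦ J y (d y)] i) y := by
    filter_upwards [ha, hb, hd, hd.mapJ hJ] with y h1 h2 h3 h4 i
    fin_cases i
    exacts [h1, h2, h3, h4]
  obtain ⟨U, hU, hUo, hpU⟩ := eventually_nhds_iff.1 (hn.and hsm)
  exact ⟨U, _, hpU, hUo, fun i y hy ↦ (hU y hy).2 i, fun y hy ↦ (hU y hy).1⟩

namespace IsAdaptedFrame

variable {U : Set M} {e : Fin 4 → TangentField M} (he : IsAdaptedFrame cov J U e) {y : M}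

include he

lemma near (hy : y ∈ U) (i : Fin 4) : SmoothNear (e i) y := by
  filter_upwards [he.isOpen.mem_nhds hy] with z hz using he.smooth i z hz

lemma inner_eq (hy : y ∈ U) (i j : Fin 4) : ⟪e i y, e j y⟫_ℝ = if i = j then 1 else 0 :=
  (he.basis y hy).inner_eq i j

lemma inner_cov_skew (hcov : IsLeviCivita cov) (hy : y ∈ U) (i j : Fin 4)
    (v : TangentSpace (𝓡 4) y) :
    ⟪cov (e i) y v, e j y⟫_ℝ = - ⟪cov (e j) y v, e i y⟫_ℝ := by
  have h1 := hcov.mvfderiv_inner (he.near hy i).mdiff (he.near hy j).mdiff v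
  have h2 : (fun z ↦ ⟪e i z, e j z⟫_ℝ) =ᶠ[𝓝 y] fun _ ↦ if i = j then (1 : ℝ) else 0 := by
    filter_upwards [he.isOpen.mem_nhds hy] with z hz using he.inner_eq hz i j
  rw [mvfderiv_congr h2, mvfderiv_const, real_inner_comm (cov (e j) y v)] at h1
  simp only [zero_apply] at h1
  linarith

lemma inner_cov_self (hcov : IsLeviCivita cov) (hy : y ∈ U) (i : Fin 4)
    (v : TangentSpace (𝓡 4) y) : ⟪cov (e i) y v, e i y⟫_ℝ = 0 := by
  have := he.inner_cov_skew hcov hy i i v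
  linarith

lemma cov_one (hJ : IsKahler cov J) (hy : y ∈ U) (v : TangentSpace (𝓡 4) y) :
    cov (e 1) y v = J y (cov (e 0) y v) := by
  rw [← hJ.parallel y (e 0) (he.smooth 0 y hy) v,
    cov_congr (he.near hy 1).mdiff ((he.near hy 0).mapJ hJ).mdiff]
  filter_upwards [he.isOpen.mem_nhds hy] with z hz using (he.basis z hz).J_zero.symm

lemma cov_three (hJ : IsKahler cov J) (hy : y ∈ U) (v : TangentSpace (𝓡 4) y) :
    cov (e 3) y v = J y (cov (e 2) y v) := by
  rw [← hJ.parallel y (e 2) (he.smooth 2 y hy) v,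
    cov_congr (he.near hy 3).mdiff ((he.near hy 2).mapJ hJ).mdiff]
  filter_upwards [he.isOpen.mem_nhds hy] with z hz using (he.basis z hz).J_two.symm

end IsAdaptedFrame

/-- The connection form `v ↦ ⟨∇_v e_i, e_j⟩` of a frame. -/
noncomputable def conn (cov : Connection M) (e : Fin 4 → TangentField M) (i j : Fin 4) (y : M)
    (v : TangentSpace (𝓡 4) y) : ℝ := ⟪cov (e i) y v, e j y⟫_ℝ

namespace IsAdaptedFrame

variable {U : Set M} {e : Fin 4 → TangentField M} (he : IsAdaptedFrame cov J U e) {y : M}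

include he

lemma cov_zero_eq (hcov : IsLeviCivita cov) (hy : y ∈ U) (v : TangentSpace (𝓡 4) y) :
    cov (e 0) y v = conn cov e 0 1 y v • e 1 y + conn cov e 0 2 y v • e 2 y
      + conn cov e 0 3 y v • e 3 y := by
  conv_lhs => rw [(he.basis y hy).sum_eq (cov (e 0) y v)]
  simp only [real_inner_comm (cov (e 0) y v), he.inner_cov_self hcov hy]
  simp [conn, real_inner_comm]

/-- Since `∇J = 0`, the connection matrix is in `u(2)`: the four forms `conn 0 1`, `conn 0 2`, `conn
0 3`, `conn 2 3` determine all of it. -/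
lemma cov_one_eq (hcov : IsLeviCivita cov) (hJ : IsKahler cov J) (hy : y ∈ U)
    (v : TangentSpace (𝓡 4) y) :
    cov (e 1) y v = -conn cov e 0 1 y v • e 0 y - conn cov e 0 3 y v • e 2 y
      + conn cov e 0 2 y v • e 3 y := by
  have hb := he.basis y hy
  rw [he.cov_one hJ hy, he.cov_zero_eq hcov hy]
  simp only [map_add, map_smul, hb.J_one hJ, hb.J_two, hb.J_three hJ]
  module

lemma cov_two_eq (hcov : IsLeviCivita cov) (hJ : IsKahler cov J) (hy : y ∈ U)
    (v : TangentSpace (𝓡 4) y) :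
    cov (e 2) y v = -conn cov e 0 2 y v • e 0 y + conn cov e 0 3 y v • e 1 y
      + conn cov e 2 3 y v • e 3 y := by
  have h0 : ⟪e 0 y, cov (e 2) y v⟫_ℝ = - conn cov e 0 2 y v := by
    rw [real_inner_comm, he.inner_cov_skew hcov hy, conn]
  have h1 : ⟪e 1 y, cov (e 2) y v⟫_ℝ = conn cov e 0 3 y v := by
    rw [real_inner_comm, he.inner_cov_skew hcov hy, he.cov_one_eq hcov hJ hy]
    simp only [inner_add_left, inner_sub_left, real_inner_smul_left, he.inner_eq hy]
    simp
  conv_lhs => rw [(he.basis y hy).sum_eq (cov (e 2) y v), h0, h1]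
  rw [real_inner_comm, he.inner_cov_self hcov hy, real_inner_comm]
  simp [conn]

lemma cov_three_eq (hcov : IsLeviCivita cov) (hJ : IsKahler cov J) (hy : y ∈ U)
    (v : TangentSpace (𝓡 4) y) :
    cov (e 3) y v = -conn cov e 0 3 y v • e 0 y - conn cov e 0 2 y v • e 1 y
      - conn cov e 2 3 y v • e 2 y := by
  have hb := he.basis y hy
  rw [he.cov_three hJ hy, he.cov_two_eq hcov hJ hy]
  simp only [map_add, map_smul, hb.J_zero, hb.J_one hJ, hb.J_three hJ]
  module

end IsAdaptedFrame

end Frame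

/-! ### Consequences of the second Bianchi identity: geometry of the nullity and the form of `θ`. -/

section Structure

variable {M : Type*} [TopologicalSpace M] [ChartedSpace E4 M] [IsManifold (𝓡 4) ∞ M]
  {cov : Connection M} {x : M}
  [RiemannianBundle (fun x : M ↦ TangentSpace (𝓡 4) x)]
  [IsContMDiffRiemannianBundle (𝓡 4) ∞ E4 (fun x : M ↦ TangentSpace (𝓡 4) x)]
  {J : EndField M}

/-- The connection coefficient `⟨∇_{e_k} e_i, e_j⟩` of a frame. -/
noncomputable def coef (cov : Connection M) (e : Fin 4 → TangentField M) (i j k : Fin 4) (y : M) :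
    ℝ := conn cov e i j y (e k y)

lemma cov_eq_zero {X : TangentField M} (hX : DiffFieldAt X x) (h : ∀ᶠ y in 𝓝 x, X y = 0) :
    cov X x = 0 := by
  have h0 : DiffFieldAt (0 : TangentField M) x := mdifferentiableAt_zeroSection ..
  rw [cov_congr hX h0 h, cov.isCovariantDerivativeOn.zero]

lemma conn_add (e : Fin 4 → TangentField M) (i j : Fin 4) (y : M) (v w : TangentSpace (𝓡 4) y) :
    conn cov e i j y (v + w) = conn cov e i j y v + conn cov e i j y w := by
  simp [conn, inner_add_left]

lemma conn_smul (e : Fin 4 → TangentField M) (i j : Fin 4) (y : M) (t : ℝ)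
    (v : TangentSpace (𝓡 4) y) :
    conn cov e i j y (t • v) = t * conn cov e i j y v := by
  simp [conn, real_inner_smul_left]

namespace IsAdaptedFrame

variable {U : Set M} {e : Fin 4 → TangentField M} (he : IsAdaptedFrame cov J U e) {y : M}

include he

lemma near_coef (hcov : IsLeviCivita cov) (hy : y ∈ U) (i j k : Fin 4) :
    FnSmoothNear (coef cov e i j k) y :=
  ((he.near hy k).nab hcov (he.near hy i)).inner (he.near hy j)

lemma curvatureField_eq (hcov : IsLeviCivita cov) (hJ : IsKahler cov J) (hy : y ∈ U)
    {X Y Z : TangentField M} (hX : SmoothNear X y) (hY : SmoothNear Y y) (hZ : SmoothNear Z y) :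
    curvatureField cov X Y Z y = (scalarCurvature cov y / 2 *
      (⟪e 0 y, X y⟫_ℝ * ⟪e 1 y, Y y⟫_ℝ - ⟪e 1 y, X y⟫_ℝ * ⟪e 0 y, Y y⟫_ℝ)) •
        (⟪e 1 y, Z y⟫_ℝ • e 0 y - ⟪e 0 y, Z y⟫_ℝ • e 1 y) := by
  rw [KahlerSurface.curvatureField_eq hcov hX hY hZ, (he.basis y hy).curvature_eq hcov hJ,
    (he.basis y hy).scalarCurvature_eq hcov hJ]
  congr 2
  ring

lemma scalarCurvature_ne_zero (hcov : IsLeviCivita cov) (hJ : IsKahler cov J)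
    (hD : ∀ x : M, Module.finrank ℝ (nullity cov x) = 2) (hy : y ∈ U) :
    scalarCurvature cov y / 2 ≠ 0 := by
  rw [(he.basis y hy).scalarCurvature_eq hcov hJ, mul_div_cancel_left₀ _ two_ne_zero]
  exact (he.basis y hy).curvature_ne_zero hcov hJ (hD y)

lemma near_scalarCurvature (hcov : IsLeviCivita cov) (hJ : IsKahler cov J) (hy : y ∈ U) :
    FnSmoothNear (fun z ↦ scalarCurvature cov z / 2) y := by
  refine ((SmoothNear.curvatureField hcov (he.near hy 0) (he.near hy 1) (he.near hy 1)).inner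
    (he.near hy 0)).congr ?_
  filter_upwards [he.isOpen.mem_nhds hy] with z hz
  rw [he.curvatureField_eq hcov hJ hz (he.near hz 0) (he.near hz 1) (he.near hz 1)]
  simp only [he.inner_eq hz, real_inner_smul_left, inner_sub_left]
  simp

variable {T : Fin 4} (hT : T = 2 ∨ T = 3)

include hT

lemma inner_T (hy : y ∈ U) : ⟪e 0 y, e T y⟫_ℝ = 0 ∧ ⟪e 1 y, e T y⟫_ℝ = 0 := by
  rcases hT with rfl | rfl <;> simp only [he.inner_eq hy] <;> simp

lemma cov_curvatureField_T_right (hcov : IsLeviCivita cov) (hJ : IsKahler cov J) (hy : y ∈ U)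
    {X Z : TangentField M} (hX : SmoothNear X y) (hZ : SmoothNear Z y) :
    cov (curvatureField cov X (e T) Z) y = 0 := by
  refine cov_eq_zero (SmoothNear.curvatureField hcov hX (he.near hy T) hZ).mdiff ?_
  filter_upwards [he.isOpen.mem_nhds hy, hX.eventually, hZ.eventually] with z hz h1 h2
  rw [he.curvatureField_eq hcov hJ hz h1 (he.near hz T) h2, (he.inner_T hT hz).1,
    (he.inner_T hT hz).2]
  simp

lemma cov_curvatureField_T_left (hcov : IsLeviCivita cov) (hJ : IsKahler cov J) (hy : y ∈ U)
    {X Z : TangentField M} (hX : SmoothNear X y) (hZ : SmoothNear Z y) :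
    cov (curvatureField cov (e T) X Z) y = 0 := by
  refine cov_eq_zero (SmoothNear.curvatureField hcov (he.near hy T) hX hZ).mdiff ?_
  filter_upwards [he.isOpen.mem_nhds hy, hX.eventually, hZ.eventually] with z hz h1 h2
  rw [he.curvatureField_eq hcov hJ hz (he.near hz T) h1 h2, (he.inner_T hT hz).1,
    (he.inner_T hT hz).2]
  simp

/-- The second Bianchi identity in an adapted frame. -/
lemma bianchi (hcov : IsLeviCivita cov) (hJ : IsKahler cov J) (hy : y ∈ U) {W : TangentField M}
    (hW : SmoothNear W y) :
    cov (curvatureField cov (e 0) (e 1) W) y (e T y) = (scalarCurvature cov y / 2) •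
      ((⟪e 1 y, cov W y (e T y)⟫_ℝ • e 0 y - ⟪e 0 y, cov W y (e T y)⟫_ℝ • e 1 y) +
        (⟪e 0 y, brk (e T) (e 0) y⟫_ℝ + ⟪e 1 y, brk (e T) (e 1) y⟫_ℝ) •
          (⟪e 1 y, W y⟫_ℝ • e 0 y - ⟪e 0 y, W y⟫_ℝ • e 1 y)) := by
  have h0 := he.near hy 0
  have h1 := he.near hy 1
  have hTn := he.near hy T
  obtain ⟨i0, i1⟩ := he.inner_T hT hy
  have j00 : ⟪e 0 y, e 0 y⟫_ℝ = 1 := he.inner_eq hy 0 0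
  have j11 : ⟪e 1 y, e 1 y⟫_ℝ = 1 := he.inner_eq hy 1 1
  have j01 : ⟪e 0 y, e 1 y⟫_ℝ = 0 := he.inner_eq hy 0 1
  have j10 : ⟪e 1 y, e 0 y⟫_ℝ = 0 := he.inner_eq hy 1 0
  -- With one argument in the nullity, two of the three differentiated terms vanish identically, as
  -- do all curvatures with `e T` in one of the first two slots.
  have key := second_bianchi hcov hTn h0 h1 hW
  rw [he.cov_curvatureField_T_right hT hcov hJ hy h1 hW,
    he.cov_curvatureField_T_left hT hcov hJ hy h0 hW,
    he.curvatureField_eq hcov hJ hy h0 h1 (hTn.nab hcov hW),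
    he.curvatureField_eq hcov hJ hy (hTn.brk h0) h1 hW,
    he.curvatureField_eq hcov hJ hy h1 hTn (h0.nab hcov hW),
    he.curvatureField_eq hcov hJ hy (h0.brk h1) hTn hW,
    he.curvatureField_eq hcov hJ hy hTn h0 (h1.nab hcov hW),
    he.curvatureField_eq hcov hJ hy (h1.brk hTn) h0 hW, i0, i1, j00, j11, j01, j10,
    brk_swap (e 1) (e T)] at key
  simp only [zero_apply, inner_neg_right] at key
  rw [← sub_eq_zero, ← key]
  module

/-- The nullity is totally geodesic. -/
lemma coef_eq_zero (hcov : IsLeviCivita cov) (hJ : IsKahler cov J)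
    (hD : ∀ x : M, Module.finrank ℝ (nullity cov x) = 2) (hy : y ∈ U) :
    coef cov e 0 2 T y = 0 ∧ coef cov e 0 3 T y = 0 := by
  have h2 := he.near hy 2
  have key := he.bianchi hT hcov hJ hy h2
  -- The choice `W = e 2` makes the left side of `bianchi` vanish. Since `c ≠ 0`, the `E`-components
  -- of `∇_{e T} e 2` must vanish too.
  have hz : cov (curvatureField cov (e 0) (e 1) (e 2)) y = 0 := by
    refine cov_eq_zero (SmoothNear.curvatureField hcov (he.near hy 0) (he.near hy 1) h2).mdiff ?_
    filter_upwards [he.isOpen.mem_nhds hy] with z hz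
    rw [he.curvatureField_eq hcov hJ hz (he.near hz 0) (he.near hz 1) (he.near hz 2)]
    simp [he.inner_eq hz]
  have hk := he.scalarCurvature_ne_zero hcov hJ hD hy
  rw [hz, he.inner_eq hy 1 2, he.inner_eq hy 0 2, real_inner_comm _ (e 1 y),
    real_inner_comm _ (e 0 y), he.inner_cov_skew hcov hy 2 0, he.cov_two_eq hcov hJ hy] at key
  have key2 := (smul_eq_zero.1 key.symm).resolve_left hk
  have k0 := congr(⟪e 0 y, $key2⟫_ℝ)
  have k1 := congr(⟪e 1 y, $key2⟫_ℝ)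
  simp only [inner_add_left, inner_sub_right, inner_add_right, real_inner_smul_left,
    real_inner_smul_right, he.inner_eq hy, inner_zero_right] at k0 k1
  simp at k0 k1
  exact ⟨k1, k0⟩

end IsAdaptedFrame

/-- The coefficients of `θ` in an adapted frame. -/
noncomputable def thetaCoef (cov : Connection M) (e : Fin 4 → TangentField M) (T : Fin 4) (y : M) :
    ℝ := - coef cov e T 0 0 y - coef cov e T 1 1 y

namespace IsAdaptedFrame

variable {U : Set M} {e : Fin 4 → TangentField M} (he : IsAdaptedFrame cov J U e) {y : M}

include he

lemma thetaCoef_two (hcov : IsLeviCivita cov) (hJ : IsKahler cov J) (hy : y ∈ U) :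
    thetaCoef cov e 2 y = coef cov e 0 2 0 y - coef cov e 0 3 1 y := by
  rw [thetaCoef, coef, coef, conn, conn, he.cov_two_eq hcov hJ hy, he.cov_two_eq hcov hJ hy]
  simp only [coef, inner_add_left, real_inner_smul_left, he.inner_eq hy, Fin.isValue,
    Fin.reduceEq, if_true, if_false]
  ring

lemma thetaCoef_three (hcov : IsLeviCivita cov) (hJ : IsKahler cov J) (hy : y ∈ U) :
    thetaCoef cov e 3 y = coef cov e 0 3 0 y + coef cov e 0 2 1 y := by
  rw [thetaCoef, coef, coef, conn, conn, he.cov_three_eq hcov hJ hy, he.cov_three_eq hcov hJ hy]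
  simp only [coef, inner_sub_left, real_inner_smul_left, he.inner_eq hy, Fin.isValue,
    Fin.reduceEq, if_true, if_false]
  ring

/-- The case `W = e 1` of `bianchi`: there `R(e₀, e₁)e₁ = c e₀`, and the `e₀`-component gives the
derivative of `c`. It identifies `thetaCoef`, defined from the connection alone, with `d ln |c|` on
the nullity. -/
lemma mvfderiv_scalarCurvature {T : Fin 4} (hT : T = 2 ∨ T = 3) (hcov : IsLeviCivita cov)
    (hJ : IsKahler cov J) (hy : y ∈ U) :
    mvfderiv (𝓡 4) (fun z ↦ scalarCurvature cov z / 2) y (e T y) =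
      scalarCurvature cov y / 2 * thetaCoef cov e T y := by
  have h0 := he.near hy 0
  have h1 := he.near hy 1
  have hTn := he.near hy T
  have hs := he.near_scalarCurvature hcov hJ hy
  have key := he.bianchi hT hcov hJ hy h1
  have hz : ∀ᶠ z in 𝓝 y, curvatureField cov (e 0) (e 1) (e 1) z =
      ((fun z ↦ scalarCurvature cov z / 2) • e 0) z := by
    filter_upwards [he.isOpen.mem_nhds hy] with z hz
    rw [he.curvatureField_eq hcov hJ hz (he.near hz 0) (he.near hz 1) (he.near hz 1)]
    simp only [he.inner_eq hz]
    simp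
  have hb0 : ⟪e 0 y, brk (e T) (e 0) y⟫_ℝ = - coef cov e T 0 0 y := by
    rw [hcov.torsion hTn.mdiff h0.mdiff, inner_sub_right, real_inner_comm,
      he.inner_cov_self hcov hy, real_inner_comm, zero_sub]
    rfl
  have hb1 : ⟪e 1 y, brk (e T) (e 1) y⟫_ℝ = - coef cov e T 1 1 y := by
    rw [hcov.torsion hTn.mdiff h1.mdiff, inner_sub_right, real_inner_comm,
      he.inner_cov_self hcov hy, real_inner_comm, zero_sub]
    rfl
  rw [cov_congr (SmoothNear.curvatureField hcov h0 h1 h1).mdiff (hs.smul h0).mdiff hz,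
    cov_smul hs.mdiff h0.mdiff, hb0, hb1] at key
  have k0 := congr(⟪e 0 y, $key⟫_ℝ)
  have e1 : ⟪e 1 y, cov (e 1) y (e T y)⟫_ℝ = 0 := by
    rw [real_inner_comm, he.inner_cov_self hcov hy]
  have e0 : ⟪e 0 y, cov (e 0) y (e T y)⟫_ℝ = 0 := by
    rw [real_inner_comm, he.inner_cov_self hcov hy]
  simp only [inner_sub_right, inner_add_right, real_inner_smul_right, he.inner_eq hy, e1, e0] at k0
  simp at k0
  rw [k0, thetaCoef]
  ring

lemma theta_eq (hcov : IsLeviCivita cov) (hJ : IsKahler cov J)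
    (hD : ∀ x : M, Module.finrank ℝ (nullity cov x) = 2) (hy : y ∈ U) (v : TangentSpace (𝓡 4) y) :
    theta cov y v = thetaCoef cov e 2 y * ⟪e 2 y, v⟫_ℝ + thetaCoef cov e 3 y * ⟪e 3 y, v⟫_ℝ := by
  have hk := he.scalarCurvature_ne_zero hcov hJ hD hy
  have hlog := mvfderiv_comp_real (f := fun z ↦ scalarCurvature cov z / 2) (x := y)
    (Real.hasDerivAt_log hk) (he.near_scalarCurvature hcov hJ hy).mdiff
  rw [theta, ContinuousLinearMap.comp_apply, (he.basis y hy).starProjection_eq (hD y), hlog, map_add,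
    map_smul, map_smul, he.mvfderiv_scalarCurvature (Or.inl rfl) hcov hJ hy,
    he.mvfderiv_scalarCurvature (Or.inr rfl) hcov hJ hy]
  simp only [smul_eq_mul]
  generalize scalarCurvature cov y / 2 = k at hk
  field_simp

lemma thetaSharp_eq (hcov : IsLeviCivita cov) (hJ : IsKahler cov J)
    (hD : ∀ x : M, Module.finrank ℝ (nullity cov x) = 2) (hy : y ∈ U) :
    thetaSharp cov y = thetaCoef cov e 2 y • e 2 y + thetaCoef cov e 3 y • e 3 y := by
  refine ext_inner_right ℝ fun v ↦ ?_
  rw [thetaSharp, InnerProductSpace.toDual_symm_apply, he.theta_eq hcov hJ hD hy, inner_add_left,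
    real_inner_smul_left, real_inner_smul_left]

end IsAdaptedFrame

end Structure

/-! ### Riccati equations along the nullity and their invariants. -/

section Riccati

variable {M : Type*} [TopologicalSpace M] [ChartedSpace E4 M] [IsManifold (𝓡 4) ∞ M]
  {cov : Connection M}
  [RiemannianBundle (fun x : M ↦ TangentSpace (𝓡 4) x)]
  [IsContMDiffRiemannianBundle (𝓡 4) ∞ E4 (fun x : M ↦ TangentSpace (𝓡 4) x)]
  {J : EndField M}

lemma conn_frame (e : Fin 4 → TangentField M) (i j k : Fin 4) (y : M) :
    conn cov e i j y (e k y) = coef cov e i j k y := rfl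

/-- A determinant built from the connection coefficients of an adapted frame. -/
noncomputable def detCoef (cov : Connection M) (e : Fin 4 → TangentField M) (y : M) : ℝ :=
  coef cov e 0 3 0 y * coef cov e 0 2 1 y - coef cov e 0 2 0 y * coef cov e 0 3 1 y

namespace IsAdaptedFrame

variable {U : Set M} {e : Fin 4 → TangentField M} (he : IsAdaptedFrame cov J U e) {y : M}
  (hcov : IsLeviCivita cov) (hJ : IsKahler cov J)
  (hD : ∀ x : M, Module.finrank ℝ (nullity cov x) = 2)

include he hcov hJ hD

lemma conn_eq {j : Fin 4} (hj : j = 2 ∨ j = 3) (hy : y ∈ U) (v : TangentSpace (𝓡 4) y) :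
    conn cov e 0 j y v = ⟪e 0 y, v⟫_ℝ * coef cov e 0 j 0 y + ⟪e 1 y, v⟫_ℝ * coef cov e 0 j 1 y := by
  have h2 := he.coef_eq_zero (Or.inl rfl) hcov hJ hD hy
  have h3 := he.coef_eq_zero (Or.inr rfl) hcov hJ hD hy
  conv_lhs => rw [(he.basis y hy).sum_eq v]
  simp only [conn_add, conn_smul, conn_frame]
  rcases hj with rfl | rfl <;> simp [h2, h3]

/-- Expand `⟪R(e_T, e_k)e₀, e_j⟫ = 0`. The term differentiating `⟪∇_{e_T} e₀, e_j⟫` disappears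
because the nullity is totally geodesic. -/
lemma dir_coef {T j : Fin 4} (hT : T = 2 ∨ T = 3) (hj : j = 2 ∨ j = 3) (hy : y ∈ U) (k : Fin 4) :
    dir (e T) (coef cov e 0 j k) y =
      ⟪e 0 y, cov (e k) y (e T y) - cov (e T) y (e k y)⟫_ℝ * coef cov e 0 j 0 y
      + ⟪e 1 y, cov (e k) y (e T y) - cov (e T) y (e k y)⟫_ℝ * coef cov e 0 j 1 y
      + ⟪cov (e 0) y (e k y), cov (e j) y (e T y)⟫_ℝ
      - ⟪cov (e 0) y (e T y), cov (e j) y (e k y)⟫_ℝ := by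
  have hTn := he.near hy T
  have hk := he.near hy k
  have h := inner_curvatureField hcov hTn hk (he.near hy 0) (he.near hy j)
  have hz : ⟪curvatureField cov (e T) (e k) (e 0) y, e j y⟫_ℝ = 0 := by
    rw [he.curvatureField_eq hcov hJ hy hTn hk (he.near hy 0)]
    rcases hj with rfl | rfl <;>
      simp [real_inner_smul_left, inner_sub_left, he.inner_eq hy]
  have hc : (fun z ↦ ⟪nab cov (e T) (e 0) z, e j z⟫_ℝ) =ᶠ[𝓝 y] fun _ ↦ 0 := by
    filter_upwards [he.isOpen.mem_nhds hy] with z hzU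
    rcases hj with rfl | rfl
    exacts [(he.coef_eq_zero hT hcov hJ hD hzU).1, (he.coef_eq_zero hT hcov hJ hD hzU).2]
  have hb : ⟪cov (e 0) y (brk (e T) (e k) y), e j y⟫_ℝ = _ :=
    he.conn_eq hcov hJ hD hj hy (brk (e T) (e k) y)
  rw [hz, dir_congr hc, dir_const, hb, hcov.torsion hTn.mdiff hk.mdiff] at h
  have hd : dir (e T) (fun z ↦ ⟪nab cov (e k) (e 0) z, e j z⟫_ℝ) y =
    dir (e T) (coef cov e 0 j k) y := rfl
  rw [hd] at h
  linarith

variable (hy : y ∈ U)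

include hy

/-- The Riccati equation in components. The terms with `coef 0 1` and `coef 2 3` come from the
rotation of the frame inside `E` and `D` and cancel in the invariants below. -/
lemma dir_two_coef :
    dir (e 2) (coef cov e 0 2 0) y =
      coef cov e 0 2 0 y * coef cov e 0 2 0 y
        + coef cov e 0 2 1 y * (coef cov e 0 1 2 y - coef cov e 0 3 0 y)
        + (coef cov e 2 3 2 y - coef cov e 0 1 2 y) * coef cov e 0 3 0 y ∧
    dir (e 2) (coef cov e 0 2 1) y =
      coef cov e 0 2 0 y * (coef cov e 0 2 1 y - coef cov e 0 1 2 y)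
        - coef cov e 0 2 1 y * coef cov e 0 3 1 y
        + (coef cov e 2 3 2 y - coef cov e 0 1 2 y) * coef cov e 0 3 1 y ∧
    dir (e 2) (coef cov e 0 3 0) y =
      coef cov e 0 3 0 y * coef cov e 0 2 0 y
        + coef cov e 0 3 1 y * (coef cov e 0 1 2 y - coef cov e 0 3 0 y)
        - (coef cov e 2 3 2 y - coef cov e 0 1 2 y) * coef cov e 0 2 0 y ∧
    dir (e 2) (coef cov e 0 3 1) y =
      coef cov e 0 3 0 y * (coef cov e 0 2 1 y - coef cov e 0 1 2 y)
        - coef cov e 0 3 1 y * coef cov e 0 3 1 y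
        - (coef cov e 2 3 2 y - coef cov e 0 1 2 y) * coef cov e 0 2 1 y := by
  have h2 := he.coef_eq_zero (Or.inl rfl) hcov hJ hD hy
  have h3 := he.coef_eq_zero (Or.inr rfl) hcov hJ hD hy
  have hs := he.dir_coef hcov hJ hD (Or.inl rfl) (Or.inl rfl) hy
  have hr := he.dir_coef hcov hJ hD (Or.inl rfl) (Or.inr rfl) hy
  rw [hs 0, hs 1, hr 0, hr 1]
  simp only [he.cov_zero_eq hcov hy, he.cov_one_eq hcov hJ hy, he.cov_two_eq hcov hJ hy,
    he.cov_three_eq hcov hJ hy, conn_frame, inner_add_left, inner_sub_left, inner_add_right,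
    inner_sub_right, real_inner_smul_left, real_inner_smul_right, he.inner_eq hy, h2, h3,
    Fin.isValue, Fin.reduceEq, if_true, if_false]
  refine ⟨?_, ?_, ?_, ?_⟩ <;> ring

lemma dir_three_coef :
    dir (e 3) (coef cov e 0 2 0) y =
      coef cov e 0 2 0 y * coef cov e 0 3 0 y
        + coef cov e 0 2 1 y * (coef cov e 0 1 3 y + coef cov e 0 2 0 y)
        + (coef cov e 2 3 3 y - coef cov e 0 1 3 y) * coef cov e 0 3 0 y ∧
    dir (e 3) (coef cov e 0 2 1) y =
      coef cov e 0 2 0 y * (coef cov e 0 3 1 y - coef cov e 0 1 3 y)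
        + coef cov e 0 2 1 y * coef cov e 0 2 1 y
        + (coef cov e 2 3 3 y - coef cov e 0 1 3 y) * coef cov e 0 3 1 y ∧
    dir (e 3) (coef cov e 0 3 0) y =
      coef cov e 0 3 0 y * coef cov e 0 3 0 y
        + coef cov e 0 3 1 y * (coef cov e 0 1 3 y + coef cov e 0 2 0 y)
        - (coef cov e 2 3 3 y - coef cov e 0 1 3 y) * coef cov e 0 2 0 y ∧
    dir (e 3) (coef cov e 0 3 1) y =
      coef cov e 0 3 0 y * (coef cov e 0 3 1 y - coef cov e 0 1 3 y)
        + coef cov e 0 3 1 y * coef cov e 0 2 1 y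
        - (coef cov e 2 3 3 y - coef cov e 0 1 3 y) * coef cov e 0 2 1 y := by
  have h2 := he.coef_eq_zero (Or.inl rfl) hcov hJ hD hy
  have h3 := he.coef_eq_zero (Or.inr rfl) hcov hJ hD hy
  have hs := he.dir_coef hcov hJ hD (Or.inr rfl) (Or.inl rfl) hy
  have hr := he.dir_coef hcov hJ hD (Or.inr rfl) (Or.inr rfl) hy
  rw [hs 0, hs 1, hr 0, hr 1]
  simp only [he.cov_zero_eq hcov hy, he.cov_one_eq hcov hJ hy, he.cov_two_eq hcov hJ hy,
    he.cov_three_eq hcov hJ hy, conn_frame, inner_add_left, inner_sub_left, inner_add_right,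
    inner_sub_right, real_inner_smul_left, real_inner_smul_right, he.inner_eq hy, h2, h3,
    Fin.isValue, Fin.reduceEq, if_true, if_false]
  refine ⟨?_, ?_, ?_, ?_⟩ <;> ring

lemma thetaCoef_two_near :
    thetaCoef cov e 2 =ᶠ[𝓝 y] fun z ↦ coef cov e 0 2 0 z - coef cov e 0 3 1 z := by
  filter_upwards [he.isOpen.mem_nhds hy] with z hz using he.thetaCoef_two hcov hJ hz

lemma thetaCoef_three_near :
    thetaCoef cov e 3 =ᶠ[𝓝 y] fun z ↦ coef cov e 0 3 0 z + coef cov e 0 2 1 z := by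
  filter_upwards [he.isOpen.mem_nhds hy] with z hz using he.thetaCoef_three hcov hJ hz

lemma near_thetaCoef (T : Fin 4) : FnSmoothNear (thetaCoef cov e T) y :=
  (he.near_coef hcov hy T 0 0).neg.sub (he.near_coef hcov hy T 1 1)

lemma near_detCoef : FnSmoothNear (detCoef cov e) y :=
  ((he.near_coef hcov hy 0 3 0).mul (he.near_coef hcov hy 0 2 1)).sub
    ((he.near_coef hcov hy 0 2 0).mul (he.near_coef hcov hy 0 3 1))

lemma dir_thetaCoef_two (T : Fin 4) : dir (e T) (thetaCoef cov e 2) y =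
    dir (e T) (coef cov e 0 2 0) y - dir (e T) (coef cov e 0 3 1) y := by
  rw [dir_congr (he.thetaCoef_two_near hcov hJ hD hy),
    dir_sub (he.near_coef hcov hy 0 2 0).mdiff (he.near_coef hcov hy 0 3 1).mdiff]

lemma dir_thetaCoef_three (T : Fin 4) : dir (e T) (thetaCoef cov e 3) y =
    dir (e T) (coef cov e 0 3 0) y + dir (e T) (coef cov e 0 2 1) y := by
  rw [dir_congr (he.thetaCoef_three_near hcov hJ hD hy),
    dir_add (he.near_coef hcov hy 0 3 0).mdiff (he.near_coef hcov hy 0 2 1).mdiff]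

/-- `detCoef` is the determinant of `X ↦ (∇_X e₂)_E` on `E`, and also that of the operator for `e₃`,
which differs by `J`. A solution of `C' = C²` satisfies `(det C)' = (tr C) (det C)`, and `θ` is the
trace of `-(∇ e_T)_E`. -/
lemma dir_detCoef {T : Fin 4} (hT : T = 2 ∨ T = 3) :
    dir (e T) (detCoef cov e) y = detCoef cov e y * thetaCoef cov e T y := by
  have s0 := (he.near_coef hcov hy 0 2 0).mdiff
  have s1 := (he.near_coef hcov hy 0 2 1).mdiff
  have r0 := (he.near_coef hcov hy 0 3 0).mdiff
  have r1 := (he.near_coef hcov hy 0 3 1).mdiff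
  have h : dir (e T) (detCoef cov e) y = _ :=
    dir_sub (r0.mul s1) (s0.mul r1)
  have h1 : dir (e T) (coef cov e 0 3 0 * coef cov e 0 2 1) y = _ := dir_mul r0 s1
  have h2 : dir (e T) (coef cov e 0 2 0 * coef cov e 0 3 1) y = _ := dir_mul s0 r1
  rw [h]
  erw [h1, h2]
  rcases hT with rfl | rfl
  · obtain ⟨k1, k2, k3, k4⟩ := he.dir_two_coef hcov hJ hD hy
    rw [k1, k2, k3, k4, he.thetaCoef_two hcov hJ hy, detCoef]
    ring
  · obtain ⟨k1, k2, k3, k4⟩ := he.dir_three_coef hcov hJ hD hy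
    rw [k1, k2, k3, k4, he.thetaCoef_three hcov hJ hy, detCoef]
    ring

/-- `dθ` vanishes on the nullity. -/
lemma curl_thetaCoef : dir (e 2) (thetaCoef cov e 3) y - dir (e 3) (thetaCoef cov e 2) y
    + coef cov e 2 3 2 y * thetaCoef cov e 2 y + coef cov e 2 3 3 y * thetaCoef cov e 3 y = 0 := by
  obtain ⟨k1, k2, k3, k4⟩ := he.dir_two_coef hcov hJ hD hy
  obtain ⟨l1, l2, l3, l4⟩ := he.dir_three_coef hcov hJ hD hy
  rw [he.dir_thetaCoef_two hcov hJ hD hy, he.dir_thetaCoef_three hcov hJ hD hy, k2, k3, l1, l4,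
    he.thetaCoef_two hcov hJ hy, he.thetaCoef_three hcov hJ hy]
  ring

/-- The divergence of `θ` along the nullity. -/
lemma div_thetaCoef : dir (e 2) (thetaCoef cov e 2) y + dir (e 3) (thetaCoef cov e 3) y
    + coef cov e 2 3 3 y * thetaCoef cov e 2 y - coef cov e 2 3 2 y * thetaCoef cov e 3 y =
    thetaCoef cov e 2 y ^ 2 + thetaCoef cov e 3 y ^ 2 - 4 * detCoef cov e y := by
  obtain ⟨k1, k2, k3, k4⟩ := he.dir_two_coef hcov hJ hD hy
  obtain ⟨l1, l2, l3, l4⟩ := he.dir_three_coef hcov hJ hD hy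
  rw [he.dir_thetaCoef_two hcov hJ hD hy, he.dir_thetaCoef_three hcov hJ hD hy, k1, k4, l2, l3,
    he.thetaCoef_two hcov hJ hy, he.thetaCoef_three hcov hJ hy, detCoef]
  ring

lemma detCoef_le : 4 * detCoef cov e y ≤ thetaCoef cov e 2 y ^ 2 + thetaCoef cov e 3 y ^ 2 := by
  rw [he.thetaCoef_two hcov hJ hy, he.thetaCoef_three hcov hJ hy, detCoef]
  -- The difference of the two sides is exactly the sum of these two squares.
  nlinarith [sq_nonneg (coef cov e 0 2 0 y + coef cov e 0 3 1 y),
    sq_nonneg (coef cov e 0 3 0 y - coef cov e 0 2 1 y)]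

/-- The derivative of `|θ|² / 4` along the nullity. -/
lemma thetaCoef_mul_dir {T : Fin 4} (hT : T = 2 ∨ T = 3) :
    thetaCoef cov e 2 y * dir (e T) (thetaCoef cov e 2) y
      + thetaCoef cov e 3 y * dir (e T) (thetaCoef cov e 3) y =
    (thetaCoef cov e 2 y ^ 2 + thetaCoef cov e 3 y ^ 2 - 2 * detCoef cov e y)
      * thetaCoef cov e T y := by
  rw [he.dir_thetaCoef_two hcov hJ hD hy, he.dir_thetaCoef_three hcov hJ hD hy]
  rcases hT with rfl | rfl
  · obtain ⟨k1, k2, k3, k4⟩ := he.dir_two_coef hcov hJ hD hy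
    rw [k1, k2, k3, k4, he.thetaCoef_two hcov hJ hy, he.thetaCoef_three hcov hJ hy, detCoef]
    ring
  · obtain ⟨k1, k2, k3, k4⟩ := he.dir_three_coef hcov hJ hD hy
    rw [k1, k2, k3, k4, he.thetaCoef_two hcov hJ hy, he.thetaCoef_three hcov hJ hy, detCoef]
    ring

end IsAdaptedFrame

end Riccati

/-! ### The invariants `|θ|²` and `twist` as global functions, and the components of `dθ`. -/

section Global

variable {M : Type*} [TopologicalSpace M] [ChartedSpace E4 M] [IsManifold (𝓡 4) ∞ M]
  {cov : Connection M}
  [RiemannianBundle (fun x : M ↦ TangentSpace (𝓡 4) x)]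
  [IsContMDiffRiemannianBundle (𝓡 4) ∞ E4 (fun x : M ↦ TangentSpace (𝓡 4) x)]
  {J : EndField M}

/-- The divergence of `θ^♯`, multiplied by `-1 / 4`. -/
noncomputable def twist (cov : Connection M) (x : M) : ℝ :=
  - (LinearMap.trace ℝ (TangentSpace (𝓡 4) x)
    (cov (thetaSharp cov) x : TangentSpace (𝓡 4) x →ₗ[ℝ] TangentSpace (𝓡 4) x)) / 4

/-- The coefficients of `dθ` in an adapted frame are `mixedTwo i` on `(e i, e 2)` and `mixedThree i`
on `(e i, e 3)`, for `i = 0, 1`. -/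
noncomputable def mixedTwo (cov : Connection M) (e : Fin 4 → TangentField M) (i : Fin 4) (y : M) :
    ℝ := dir (e i) (thetaCoef cov e 2) y - coef cov e 2 3 i y * thetaCoef cov e 3 y

/-- See `mixedTwo`. -/
noncomputable def mixedThree (cov : Connection M) (e : Fin 4 → TangentField M) (i : Fin 4) (y : M) :
    ℝ := dir (e i) (thetaCoef cov e 3) y + coef cov e 2 3 i y * thetaCoef cov e 2 y

/-- A point is either in the closure of `{g ≠ 0}`, where continuity of `f` suffices, or has a
neighbourhood with `g = 0`. It is used with `g = |θ|²`, to pass over the zeros of `θ`. -/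
lemma FnSmoothNear.eq_zero_of_forall_ne_zero {f g : M → ℝ} {y : M} (hf : FnSmoothNear f y)
    (h : ∀ᶠ z in 𝓝 y, g z ≠ 0 → f z = 0) (h0 : (∀ᶠ z in 𝓝 y, g z = 0) → f y = 0) : f y = 0 := by
  by_contra hne
  refine hne (h0 ?_)
  filter_upwards [h, hf.self.continuousAt.eventually_ne hne] with z h1 h2
  by_contra h3
  exact h2 (h1 h3)

lemma theta_eq_inner (x : M) (v : TangentSpace (𝓡 4) x) :
    theta cov x v = ⟪thetaSharp cov x, v⟫_ℝ := by
  rw [thetaSharp, InnerProductSpace.toDual_symm_apply]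

namespace IsAdaptedFrame

variable {U : Set M} {e : Fin 4 → TangentField M} (he : IsAdaptedFrame cov J U e) {y : M}

include he in
lemma mvfderiv_eq_sum (hy : y ∈ U) (f : M → ℝ) (v : TangentSpace (𝓡 4) y) :
    mvfderiv (𝓡 4) f y v = ⟪e 0 y, v⟫_ℝ * dir (e 0) f y + ⟪e 1 y, v⟫_ℝ * dir (e 1) f y
      + ⟪e 2 y, v⟫_ℝ * dir (e 2) f y + ⟪e 3 y, v⟫_ℝ * dir (e 3) f y := by
  conv_lhs => rw [(he.basis y hy).sum_eq v]
  simp [dir]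

include he in
lemma conn_eq_sum (hy : y ∈ U) (i j : Fin 4) (v : TangentSpace (𝓡 4) y) :
    conn cov e i j y v = ⟪e 0 y, v⟫_ℝ * coef cov e i j 0 y + ⟪e 1 y, v⟫_ℝ * coef cov e i j 1 y
      + ⟪e 2 y, v⟫_ℝ * coef cov e i j 2 y + ⟪e 3 y, v⟫_ℝ * coef cov e i j 3 y := by
  conv_lhs => rw [(he.basis y hy).sum_eq v]
  simp only [conn_add, conn_smul, conn_frame]

variable (hcov : IsLeviCivita cov) (hJ : IsKahler cov J)
  (hD : ∀ x : M, Module.finrank ℝ (nullity cov x) = 2) (hy : y ∈ U)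

include he hcov hJ hD hy

lemma near_thetaSharp : SmoothNear (thetaSharp cov) y := by
  refine (((he.near_thetaCoef hcov hJ hD hy 2).smul (he.near hy 2)).add
    ((he.near_thetaCoef hcov hJ hD hy 3).smul (he.near hy 3))).congr ?_
  filter_upwards [he.isOpen.mem_nhds hy] with z hz using he.thetaSharp_eq hcov hJ hD hz

lemma norm_thetaSharp_sq :
    ‖thetaSharp cov y‖ ^ 2 = thetaCoef cov e 2 y ^ 2 + thetaCoef cov e 3 y ^ 2 := by
  rw [← real_inner_self_eq_norm_sq, he.thetaSharp_eq hcov hJ hD hy]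
  simp only [inner_add_left, inner_add_right, real_inner_smul_left, real_inner_smul_right,
    he.inner_eq hy, Fin.isValue, Fin.reduceEq, if_true, if_false]
  ring

lemma cov_thetaSharp (v : TangentSpace (𝓡 4) y) : cov (thetaSharp cov) y v =
    thetaCoef cov e 2 y • cov (e 2) y v + mvfderiv (𝓡 4) (thetaCoef cov e 2) y v • e 2 y
      + (thetaCoef cov e 3 y • cov (e 3) y v + mvfderiv (𝓡 4) (thetaCoef cov e 3) y v • e 3 y) := by
  have t2 := he.near_thetaCoef hcov hJ hD hy 2
  have t3 := he.near_thetaCoef hcov hJ hD hy 3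
  have h : ∀ᶠ z in 𝓝 y, thetaSharp cov z = (thetaCoef cov e 2 • e 2 + thetaCoef cov e 3 • e 3) z := by
    filter_upwards [he.isOpen.mem_nhds hy] with z hz using he.thetaSharp_eq hcov hJ hD hz
  rw [cov_congr (he.near_thetaSharp hcov hJ hD hy).mdiff
    ((t2.smul (he.near hy 2)).add (t3.smul (he.near hy 3))).mdiff h,
    cov_add (t2.smul (he.near hy 2)).mdiff (t3.smul (he.near hy 3)).mdiff,
    cov_smul t2.mdiff (he.near hy 2).mdiff, cov_smul t3.mdiff (he.near hy 3).mdiff]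

/-- In the trace, `D` contributes the left side of `div_thetaCoef`, that is `|θ|² - 4 detCoef`, and
`E` contributes `-|θ|²`. Hence `detCoef` does not depend on the frame. -/
lemma twist_eq : twist cov y = detCoef cov e y := by
  have h2 := he.coef_eq_zero (Or.inl rfl) hcov hJ hD hy
  have h3 := he.coef_eq_zero (Or.inr rfl) hcov hJ hD hy
  have hd := he.div_thetaCoef hcov hJ hD hy
  have e2 := he.thetaCoef_two hcov hJ hy
  have e3 := he.thetaCoef_three hcov hJ hy
  rw [twist, LinearMap.trace_eq_sum_inner _ (he.basis y hy).basis, Fin.sum_univ_four]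
  simp only [IsAdaptedBasis.basis_apply, ContinuousLinearMap.coe_coe, he.cov_thetaSharp hcov hJ hD hy,
    he.cov_two_eq hcov hJ hy, he.cov_three_eq hcov hJ hy, inner_add_right, inner_sub_right,
    real_inner_smul_right, he.inner_eq hy, conn_frame, Fin.isValue, Fin.reduceEq, if_true, if_false,
    h2, h3]
  simp only [dir] at hd
  generalize mvfderiv (𝓡 4) (thetaCoef cov e 2) y (e 2 y) = A at hd ⊢
  generalize mvfderiv (𝓡 4) (thetaCoef cov e 3) y (e 3 y) = B at hd ⊢
  rw [e2, e3] at hd ⊢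
  linarith

lemma norm_thetaSharp_sq_near : (fun z ↦ ‖thetaSharp cov z‖ ^ 2) =ᶠ[𝓝 y]
    fun z ↦ thetaCoef cov e 2 z * thetaCoef cov e 2 z + thetaCoef cov e 3 z * thetaCoef cov e 3 z := by
  filter_upwards [he.isOpen.mem_nhds hy] with z hz
  rw [he.norm_thetaSharp_sq hcov hJ hD hz]
  ring

lemma twist_near : twist cov =ᶠ[𝓝 y] detCoef cov e := by
  filter_upwards [he.isOpen.mem_nhds hy] with z hz using he.twist_eq hcov hJ hD hz

lemma near_norm_thetaSharp_sq : FnSmoothNear (fun z ↦ ‖thetaSharp cov z‖ ^ 2) y :=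
  have t2 := he.near_thetaCoef hcov hJ hD hy 2
  have t3 := he.near_thetaCoef hcov hJ hD hy 3
  ((t2.mul t2).add (t3.mul t3)).congr (he.norm_thetaSharp_sq_near hcov hJ hD hy)

lemma near_twist : FnSmoothNear (twist cov) y :=
  (he.near_detCoef hcov hJ hD hy).congr (he.twist_near hcov hJ hD hy)

lemma twist_le : 4 * twist cov y ≤ ‖thetaSharp cov y‖ ^ 2 := by
  rw [he.norm_thetaSharp_sq hcov hJ hD hy, he.twist_eq hcov hJ hD hy]
  exact he.detCoef_le hcov hJ hD hy

lemma dir_twist {T : Fin 4} (hT : T = 2 ∨ T = 3) :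
    dir (e T) (twist cov) y = twist cov y * thetaCoef cov e T y := by
  rw [dir_congr (he.twist_near hcov hJ hD hy), he.twist_eq hcov hJ hD hy,
    he.dir_detCoef hcov hJ hD hy hT]

lemma dir_norm_sq (i : Fin 4) : dir (e i) (fun z ↦ ‖thetaSharp cov z‖ ^ 2) y =
    2 * (thetaCoef cov e 2 y * dir (e i) (thetaCoef cov e 2) y
      + thetaCoef cov e 3 y * dir (e i) (thetaCoef cov e 3) y) := by
  have t2 := he.near_thetaCoef hcov hJ hD hy 2
  have t3 := he.near_thetaCoef hcov hJ hD hy 3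
  rw [dir_congr (he.norm_thetaSharp_sq_near hcov hJ hD hy),
    dir_add (t2.mul t2).mdiff (t3.mul t3).mdiff, dir_mul t2.mdiff t2.mdiff,
    dir_mul t3.mdiff t3.mdiff]
  ring

lemma dir_norm_sq_nullity {T : Fin 4} (hT : T = 2 ∨ T = 3) :
    dir (e T) (fun z ↦ ‖thetaSharp cov z‖ ^ 2) y =
      2 * (‖thetaSharp cov y‖ ^ 2 - 2 * twist cov y) * thetaCoef cov e T y := by
  rw [he.dir_norm_sq hcov hJ hD hy, he.thetaCoef_mul_dir hcov hJ hD hy hT,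
    he.norm_thetaSharp_sq hcov hJ hD hy, he.twist_eq hcov hJ hD hy]
  ring

/-- The `coef 2 3` terms of `mixedTwo` and `mixedThree` cancel. For `i = 0, 1` the right side is `2
dθ(e_i, θ^♯)`, which is how closedness of `θ` gives (c). -/
lemma dir_norm_sq_mixed (i : Fin 4) :
    dir (e i) (fun z ↦ ‖thetaSharp cov z‖ ^ 2) y =
      2 * (thetaCoef cov e 2 y * mixedTwo cov e i y + thetaCoef cov e 3 y * mixedThree cov e i y) := by
  rw [he.dir_norm_sq hcov hJ hD hy, mixedTwo, mixedThree]
  ring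

/-- The bracket of fields of an adapted frame applied to a function whose differential is a
multiple of `θ`. -/
lemma dir_comm_mixed {f g : M → ℝ} (hf : FnSmoothNear f y) (hg : FnSmoothNear g y) {i : Fin 4}
    (hi : i = 0 ∨ i = 1) (h0 : ∀ᶠ z in 𝓝 y, dir (e 0) f z = 0) (h1 : ∀ᶠ z in 𝓝 y, dir (e 1) f z = 0)
    (hT : ∀ T : Fin 4, (T = 2 ∨ T = 3) → ∀ᶠ z in 𝓝 y, dir (e T) f z = g z * thetaCoef cov e T z) :
    dir (e i) g y * thetaCoef cov e 2 y + g y * mixedTwo cov e i y = 0 ∧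
      dir (e i) g y * thetaCoef cov e 3 y + g y * mixedThree cov e i y = 0 := by
  have h2 := he.coef_eq_zero (Or.inl rfl) hcov hJ hD hy
  have h3 := he.coef_eq_zero (Or.inr rfl) hcov hJ hD hy
  have hi0 : dir (e i) f =ᶠ[𝓝 y] fun _ ↦ 0 := by
    rcases hi with rfl | rfl
    exacts [h0, h1]
  have main : ∀ T : Fin 4, (T = 2 ∨ T = 3) →
      g y * dir (e i) (thetaCoef cov e T) y + thetaCoef cov e T y * dir (e i) g y =
        ⟪e 2 y, brk (e i) (e T) y⟫_ℝ * (g y * thetaCoef cov e 2 y)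
          + ⟪e 3 y, brk (e i) (e T) y⟫_ℝ * (g y * thetaCoef cov e 3 y) := by
    intro T hT'
    -- Here `df = g θ` near `y`. Computing `[e_i, e_T] f` in two ways gives the `(e_i,
    -- e_T)`-component of `dg ∧ θ + g dθ = 0`.
    have hc := dir_comm hf.self (he.smooth i y hy) (he.smooth T y hy)
    rw [dir_congr (hT T hT'), dir_mul hg.mdiff (he.near_thetaCoef hcov hJ hD hy T).mdiff,
      dir_congr hi0, dir_const, sub_zero] at hc
    rw [hc, dir, he.mvfderiv_eq_sum hy, h0.self_of_nhds, h1.self_of_nhds,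
      (hT 2 (Or.inl rfl)).self_of_nhds, (hT 3 (Or.inr rfl)).self_of_nhds]
    ring
  have m2 := main 2 (Or.inl rfl)
  have m3 := main 3 (Or.inr rfl)
  rw [hcov.torsion (he.near hy i).mdiff (he.near hy 2).mdiff] at m2
  rw [hcov.torsion (he.near hy i).mdiff (he.near hy 3).mdiff] at m3
  rw [mixedTwo, mixedThree]
  rcases hi with rfl | rfl
  all_goals
    simp only [he.cov_zero_eq hcov hy, he.cov_one_eq hcov hJ hy, he.cov_two_eq hcov hJ hy,
      he.cov_three_eq hcov hJ hy, conn_frame, inner_add_right,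
      inner_sub_right, real_inner_smul_right, he.inner_eq hy, h2, h3,
      Fin.isValue, Fin.reduceEq, if_true, if_false] at m2 m3
    constructor <;> linarith

lemma near_mixedTwo (i : Fin 4) : FnSmoothNear (mixedTwo cov e i) y :=
  ((he.near_thetaCoef hcov hJ hD hy 2).dir (he.near hy i)).sub
    ((he.near_coef hcov hy 2 3 i).mul (he.near_thetaCoef hcov hJ hD hy 3))

lemma near_mixedThree (i : Fin 4) : FnSmoothNear (mixedThree cov e i) y :=
  ((he.near_thetaCoef hcov hJ hD hy 3).dir (he.near hy i)).add
    ((he.near_coef hcov hy 2 3 i).mul (he.near_thetaCoef hcov hJ hD hy 2))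

lemma thetaCoef_near_eq_zero (h : ∀ᶠ z in 𝓝 y, ‖thetaSharp cov z‖ ^ 2 = 0) :
    thetaCoef cov e 2 =ᶠ[𝓝 y] (fun _ ↦ 0) ∧ thetaCoef cov e 3 =ᶠ[𝓝 y] (fun _ ↦ 0) := by
  refine eventually_and.1 ?_
  filter_upwards [h, he.isOpen.mem_nhds hy] with z h1 hz
  rw [he.norm_thetaSharp_sq hcov hJ hD hz] at h1
  constructor <;> nlinarith [sq_nonneg (thetaCoef cov e 2 z), sq_nonneg (thetaCoef cov e 3 z)]

/-- If `|θ|²` is constant along the orthogonal complement of the nullity, then `dθ = 0`. -/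
lemma mixed_eq_zero (h0 : ∀ z ∈ U, dir (e 0) (fun z ↦ ‖thetaSharp cov z‖ ^ 2) z = 0)
    (h1 : ∀ z ∈ U, dir (e 1) (fun z ↦ ‖thetaSharp cov z‖ ^ 2) z = 0) {i : Fin 4}
    (hi : i = 0 ∨ i = 1) : mixedTwo cov e i y = 0 ∧ mixedThree cov e i y = 0 := by
  have main : ∀ z ∈ U, ‖thetaSharp cov z‖ ^ 2 ≠ 0 →
      mixedTwo cov e i z = 0 ∧ mixedThree cov e i z = 0 := by
    intro z hz hne
    have hG := he.near_norm_thetaSharp_sq hcov hJ hD hz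
    have hd := he.near_twist hcov hJ hD hz
    have hU := he.isOpen.mem_nhds hz
    have hg : FnSmoothNear (fun z ↦ 2 * (‖thetaSharp cov z‖ ^ 2 - 2 * twist cov z)) z :=
      (FnSmoothNear.const 2 z).mul (hG.sub ((FnSmoothNear.const 2 z).mul hd))
    obtain ⟨k2, k3⟩ := he.dir_comm_mixed hcov hJ hD hz hG hg hi (by filter_upwards [hU] using h0)
      (by filter_upwards [hU] using h1)
      (fun T hT ↦ by filter_upwards [hU] with w hw using he.dir_norm_sq_nullity hcov hJ hD hw hT)
    have k : dir (e i) (fun z ↦ ‖thetaSharp cov z‖ ^ 2) z = 0 := by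
      rcases hi with rfl | rfl
      exacts [h0 z hz, h1 z hz]
    rw [he.dir_norm_sq_mixed hcov hJ hD hz] at k
    have hn := he.norm_thetaSharp_sq hcov hJ hD hz
    have hle := he.twist_le hcov hJ hD hz
    have hpos : 0 < ‖thetaSharp cov z‖ ^ 2 := lt_of_le_of_ne (sq_nonneg _) hne.symm
    generalize ‖thetaSharp cov z‖ ^ 2 = G at *
    generalize dir (e i) (fun z ↦ 2 * (‖thetaSharp cov z‖ ^ 2 - 2 * twist cov z)) z = dg at *
    -- Contraction with `θ^♯`: the `dθ` term becomes a multiple of `e_i |θ|² = 0`, leaving `dg *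
    -- |θ|² = 0`.
    have hdg : dg = 0 := by
      have : dg * G = 0 := by
        rw [hn]
        linear_combination thetaCoef cov e 2 z * k2 + thetaCoef cov e 3 z * k3
          - (G - 2 * twist cov z) * k
      exact (mul_eq_zero.1 this).resolve_right hne
    rw [hdg, zero_mul, zero_add] at k2 k3
    -- By `4 twist ≤ |θ|²` this factor is at least `|θ|² > 0`.
    have hN : 2 * (G - 2 * twist cov z) ≠ 0 := by
      have : 0 < 2 * (G - 2 * twist cov z) := by linarith
      exact this.ne'
    exact ⟨(mul_eq_zero.1 k2).resolve_left hN, (mul_eq_zero.1 k3).resolve_left hN⟩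
  constructor
  · refine (he.near_mixedTwo hcov hJ hD hy i).eq_zero_of_forall_ne_zero
      (g := fun z ↦ ‖thetaSharp cov z‖ ^ 2) ?_ fun h ↦ ?_
    · filter_upwards [he.isOpen.mem_nhds hy] with z hz hne using (main z hz hne).1
    · obtain ⟨k2, k3⟩ := he.thetaCoef_near_eq_zero hcov hJ hD hy h
      rw [mixedTwo, dir_congr k2, dir_const, k3.self_of_nhds]
      ring
  · refine (he.near_mixedThree hcov hJ hD hy i).eq_zero_of_forall_ne_zero
      (g := fun z ↦ ‖thetaSharp cov z‖ ^ 2) ?_ fun h ↦ ?_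
    · filter_upwards [he.isOpen.mem_nhds hy] with z hz hne using (main z hz hne).2
    · obtain ⟨k2, k3⟩ := he.thetaCoef_near_eq_zero hcov hJ hD hy h
      rw [mixedThree, dir_congr k3, dir_const, k2.self_of_nhds]
      ring

/-- If `dθ = 0`, then `twist` is constant along the orthogonal complement of the nullity. -/
lemma dir_twist_eq_zero (hm : ∀ z ∈ U, ∀ i : Fin 4, (i = 0 ∨ i = 1) →
    mixedTwo cov e i z = 0 ∧ mixedThree cov e i z = 0) {i : Fin 4} (hi : i = 0 ∨ i = 1) :
    dir (e i) (twist cov) y = 0 := by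
  have hG0 : ∀ z ∈ U, ∀ i : Fin 4, (i = 0 ∨ i = 1) →
      dir (e i) (fun z ↦ ‖thetaSharp cov z‖ ^ 2) z = 0 := by
    intro z hz i hi
    rw [he.dir_norm_sq_mixed hcov hJ hD hz, (hm z hz i hi).1, (hm z hz i hi).2]
    ring
  have main : ∀ z ∈ U, ‖thetaSharp cov z‖ ^ 2 ≠ 0 → dir (e i) (twist cov) z = 0 := by
    intro z hz hne
    have hG := he.near_norm_thetaSharp_sq hcov hJ hD hz
    have hd := he.near_twist hcov hJ hD hz
    have hU := he.isOpen.mem_nhds hz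
    have hg1 := (FnSmoothNear.const 2 z).mul hd
    have hg2 := hG.sub hg1
    have hg := (FnSmoothNear.const 2 z).mul hg2
    obtain ⟨k2, k3⟩ := he.dir_comm_mixed hcov hJ hD hz hG hg hi
      (by filter_upwards [hU] with w hw using hG0 w hw 0 (Or.inl rfl))
      (by filter_upwards [hU] with w hw using hG0 w hw 1 (Or.inr rfl))
      (fun T hT ↦ by filter_upwards [hU] with w hw using he.dir_norm_sq_nullity hcov hJ hD hw hT)
    -- The same identity with `dθ = 0` reads `dg(e_i) θ = 0`, and `dg(e_i) = -4 e_i(twist)` since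
    -- `e_i |θ|² = 0`.
    rw [dir_mul (FnSmoothNear.const 2 z).mdiff hg2.mdiff, dir_sub hG.mdiff hg1.mdiff,
      dir_mul (FnSmoothNear.const 2 z).mdiff hd.mdiff, dir_const, hG0 z hz i hi] at k2 k3
    rw [(hm z hz i hi).1] at k2
    rw [(hm z hz i hi).2] at k3
    have hn := he.norm_thetaSharp_sq hcov hJ hD hz
    have : dir (e i) (twist cov) z * ‖thetaSharp cov z‖ ^ 2 = 0 := by
      rw [hn]
      linear_combination (-1 / 4) * thetaCoef cov e 2 z * k2 + (-1 / 4) * thetaCoef cov e 3 z * k3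
    exact (mul_eq_zero.1 this).resolve_right hne
  refine ((he.near_twist hcov hJ hD hy).dir (he.near hy i)).eq_zero_of_forall_ne_zero
    (g := fun z ↦ ‖thetaSharp cov z‖ ^ 2) ?_ fun h ↦ ?_
  · filter_upwards [he.isOpen.mem_nhds hy] with z hz hne using main z hz hne
  -- On an open set where `θ = 0`, the divergence formula forces `twist = 0`.
  · have : twist cov =ᶠ[𝓝 y] fun _ ↦ 0 := by
      filter_upwards [he.thetaCoef_near_eq_zero hcov hJ hD hy h |>.1.eventually_nhds,
        he.thetaCoef_near_eq_zero hcov hJ hD hy h |>.2.eventually_nhds,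
        he.isOpen.mem_nhds hy] with z k2 k3 hz
      have := he.div_thetaCoef hcov hJ hD hz
      rw [dir_congr k2, dir_congr k3, dir_const, dir_const, k2.self_of_nhds, k3.self_of_nhds,
        ← he.twist_eq hcov hJ hD hz] at this
      linarith
    rw [dir_congr this, dir_const]

/-- The exterior derivative of `θ` in an adapted frame. -/
lemma extDerivOne_eq {X Y : TangentField M} (hX : SmoothFieldAt X y) (hY : SmoothFieldAt Y y) :
    extDerivOne (theta cov) X Y y =
      mixedTwo cov e 0 y * (⟪e 0 y, X y⟫_ℝ * ⟪e 2 y, Y y⟫_ℝ - ⟪e 2 y, X y⟫_ℝ * ⟪e 0 y, Y y⟫_ℝ)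
      + mixedTwo cov e 1 y * (⟪e 1 y, X y⟫_ℝ * ⟪e 2 y, Y y⟫_ℝ - ⟪e 2 y, X y⟫_ℝ * ⟪e 1 y, Y y⟫_ℝ)
      + mixedThree cov e 0 y * (⟪e 0 y, X y⟫_ℝ * ⟪e 3 y, Y y⟫_ℝ - ⟪e 3 y, X y⟫_ℝ * ⟪e 0 y, Y y⟫_ℝ)
      + mixedThree cov e 1 y *
        (⟪e 1 y, X y⟫_ℝ * ⟪e 3 y, Y y⟫_ℝ - ⟪e 3 y, X y⟫_ℝ * ⟪e 1 y, Y y⟫_ℝ) := by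
  have h2 := he.coef_eq_zero (Or.inl rfl) hcov hJ hD hy
  have h3 := he.coef_eq_zero (Or.inr rfl) hcov hJ hD hy
  have hc := he.curl_thetaCoef hcov hJ hD hy
  have e2 := he.thetaCoef_two hcov hJ hy
  have e3 := he.thetaCoef_three hcov hJ hy
  have hs := (he.near_thetaSharp hcov hJ hD hy).mdiff
  have hfun : ∀ Z : TangentField M, (fun z ↦ theta cov z (Z z)) = fun z ↦ ⟪thetaSharp cov z, Z z⟫_ℝ :=
    fun Z ↦ funext fun z ↦ theta_eq_inner z _
  have key : extDerivOne (theta cov) X Y y =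
      ⟪cov (thetaSharp cov) y (X y), Y y⟫_ℝ - ⟪cov (thetaSharp cov) y (Y y), X y⟫_ℝ := by
    rw [extDerivOne, hfun, hfun, theta_eq_inner, hcov.mvfderiv_inner hs hY.mdiff,
      hcov.mvfderiv_inner hs hX.mdiff]
    have ht : mlieBracket (𝓡 4) X Y y = _ := hcov.torsion hX.mdiff hY.mdiff
    rw [ht, inner_sub_right]
    ring
  rw [key, he.cov_thetaSharp hcov hJ hD hy, he.cov_thetaSharp hcov hJ hD hy]
  simp only [he.cov_two_eq hcov hJ hy, he.cov_three_eq hcov hJ hy, inner_add_left, inner_sub_left,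
    real_inner_smul_left, he.mvfderiv_eq_sum hy, he.conn_eq_sum hy, h2, h3, mixedTwo, mixedThree]
  generalize dir (e 2) (thetaCoef cov e 3) y = A at *
  -- Substituting the curl identity removes the `(e₂, e₃)`-component. The `(e₀, e₁)`-component
  -- cancels as `θ₂θ₃ - θ₃θ₂` once `e2` and `e3` are inserted.
  obtain rfl : A = dir (e 3) (thetaCoef cov e 2) y - coef cov e 2 3 2 y * thetaCoef cov e 2 y
    - coef cov e 2 3 3 y * thetaCoef cov e 3 y := by linarith
  rw [e2, e3]
  ring

end IsAdaptedFrame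

end Global

/-! ### Uniqueness for the equation `df = f α`. -/

section Uniqueness

variable {M : Type*} [TopologicalSpace M] [ChartedSpace E4 M] [IsManifold (𝓡 4) ∞ M]
  [RiemannianBundle (fun x : M ↦ TangentSpace (𝓡 4) x)]
  [IsContMDiffRiemannianBundle (𝓡 4) ∞ E4 (fun x : M ↦ TangentSpace (𝓡 4) x)]

lemma norm_apply_le_of_norm_lt {F : Type*} [NormedAddCommGroup F] [NormedSpace ℝ F] (L : E4 →L[ℝ] F)
    {C : ℝ} (hL : ‖L‖ < C) (v : E4) : ‖L v‖ ≤ C * ‖v‖ :=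
  L.le_of_opNorm_le hL.le v

/-- A function with `df = f α` that vanishes at a point vanishes near it. -/
lemma eventually_eq_zero_of_mvfderiv {f : M → ℝ} {α : OneForm M} {p : M} (hf : FnSmoothNear f p)
    (hd : ∀ᶠ y in 𝓝 p, ∀ v, mvfderiv (𝓡 4) f y v = f y * α y v) {K : ℝ} (hK0 : 0 ≤ K)
    (hK : ∀ᶠ y in 𝓝 p, ∀ v, |α y v| ≤ K * ‖v‖) (h0 : f p = 0) : ∀ᶠ y in 𝓝 p, f y = 0 := by
  have hcont : IsContinuousRiemannianBundle E4 (fun x : M ↦ TangentSpace (𝓡 4) x) := by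
    obtain ⟨g, hg, h⟩ := IsContMDiffRiemannianBundle.exists_contMDiff (IB := 𝓡 4) (n := ∞) (F := E4)
      (E := fun x : M ↦ TangentSpace (𝓡 4) x)
    exact ⟨g, hg.continuous, h⟩
  -- Grönwall's inequality is applied along chart segments from `φ p`. The constant `C` bounds the
  -- differential of the inverse chart in the Riemannian norm, which makes the bound on `α` usable
  -- in the chart.
  set φ := extChartAt (𝓡 4) p
  obtain ⟨C, hC0, hC⟩ := eventually_norm_mfderivWithin_symm_extChartAt_lt (𝓡 4) p
  rw [ModelWithCorners.range_eq_univ, nhdsWithin_univ] at hC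
  simp only [mfderivWithin_univ] at hC
  have hsymm : ContinuousAt φ.symm (φ p) := continuousAt_extChartAt_symm p
  have hnear : ∀ᶠ y in 𝓝 (φ.symm (φ p)), DiffFnAt f y ∧ (∀ v, mvfderiv (𝓡 4) f y v = f y * α y v) ∧
      ∀ v, |α y v| ≤ K * ‖v‖ := by
    rw [show φ.symm (φ p) = p from extChartAt_to_inv p]
    filter_upwards [hf.eventually, hd, hK] with y h1 h2 h3 using ⟨h1.mdiff, h2, h3⟩
  obtain ⟨r, hr, hball⟩ := Metric.eventually_nhds_iff_ball.1
    (hC.and ((hsymm.eventually hnear).and (extChartAt_target_mem_nhds p)))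
  have key : ∀ u ∈ Metric.ball (φ p) r, f (φ.symm u) = 0 := by
    intro u hu
    set w := u - φ p
    have hmem : ∀ t ∈ Set.Icc (0 : ℝ) 1, φ p + t • w ∈ Metric.ball (φ p) r := by
      intro t ht
      exact (convex_ball (φ p) r).add_smul_sub_mem (Metric.mem_ball_self hr) hu ht
    have hder : ∀ z ∈ Metric.ball (φ p) r, ∃ L : E4 →L[ℝ] ℝ, HasFDerivAt (f ∘ φ.symm) L z ∧
        ∀ v, |L v| ≤ (K * C) * |f (φ.symm z)| * ‖v‖ := by
      intro z hz
      obtain ⟨b1, ⟨b2, b3, b4⟩, b5⟩ := hball z hz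
      have hs : MDifferentiableAt 𝓘(ℝ, E4) (𝓡 4) φ.symm z := by
        have := mdifferentiableWithinAt_extChartAt_symm (I := 𝓡 4) b5
        rwa [ModelWithCorners.range_eq_univ, mdifferentiableWithinAt_univ] at this
      have hc := b2.hasMFDerivAt.comp z hs.hasMFDerivAt
      refine ⟨_, hc.hasFDerivAt, fun v ↦ ?_⟩
      have h1 : _ = f (φ.symm z) * _ := b3 (mfderiv 𝓘(ℝ, E4) (𝓡 4) φ.symm z v)
      have h2 := b4 (mfderiv 𝓘(ℝ, E4) (𝓡 4) φ.symm z v)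
      have h3 := norm_apply_le_of_norm_lt (F := TangentSpace (𝓡 4) (φ.symm z)) _ b1 v
      replace h1 : ((mvfderiv (𝓡 4) f (φ.symm z)).comp (mfderiv 𝓘(ℝ, E4) (𝓡 4) φ.symm z)) v =
        f (φ.symm z) * α (φ.symm z) (mfderiv 𝓘(ℝ, E4) (𝓡 4) φ.symm z v) := h1
      change |((mvfderiv (𝓡 4) f (φ.symm z)).comp (mfderiv 𝓘(ℝ, E4) (𝓡 4) φ.symm z)) v| ≤ _
      rw [h1, abs_mul]
      have h5 : |α (φ.symm z) (mfderiv 𝓘(ℝ, E4) (𝓡 4) φ.symm z v)| ≤ K * (C * ‖v‖) :=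
        h2.trans (mul_le_mul_of_nonneg_left h3 hK0)
      calc _ ≤ |f (φ.symm z)| * (K * (C * ‖v‖)) := mul_le_mul_of_nonneg_left h5 (abs_nonneg _)
        _ = _ := by ring
    have hg : ∀ t ∈ Set.Icc (0 : ℝ) 1, ∃ g' : ℝ,
        HasDerivAt (fun t : ℝ ↦ f (φ.symm (φ p + t • w))) g' t ∧
        |g'| ≤ (K * C * ‖w‖) * |f (φ.symm (φ p + t • w))| := by
      intro t ht
      obtain ⟨L, h1, h2⟩ := hder _ (hmem t ht)
      have h3 : HasDerivAt (fun t : ℝ ↦ φ p + t • w) w t := by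
        simpa using ((hasDerivAt_id t).smul_const w).const_add (φ p)
      refine ⟨L w, HasFDerivAt.comp_hasDerivAt (l := f ∘ φ.symm) t h1 h3, (h2 w).trans_eq (by ring)⟩
    choose! g' hg1 hg2 using hg
    -- Along the segment `|h'| ≤ const * |h|` and `h 0 = 0`, so `h` vanishes up to the endpoint `u`,
    -- reached at time 1.
    have := eq_zero_of_abs_deriv_le_mul_abs_self_of_eq_zero_right (a := 0) (b := 1)
      (f := fun t : ℝ ↦ f (φ.symm (φ p + t • w))) (f' := g') (K := K * C * ‖w‖)
      (fun t ht ↦ (hg1 t ht).continuousAt.continuousWithinAt)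
      (fun t ht ↦ (hg1 t (Set.Ico_subset_Icc_self ht)).hasDerivWithinAt)
      (by simpa [show φ.symm (φ p) = p from extChartAt_to_inv p] using h0)
      (fun t ht ↦ hg2 t (Set.Ico_subset_Icc_self ht)) 1 (by simp)
    simpa [w] using this
  have hcφ : ContinuousAt φ p := continuousAt_extChartAt p
  filter_upwards [hcφ.eventually (Metric.ball_mem_nhds _ hr), extChartAt_source_mem_nhds (I := 𝓡 4) p]
    with y h1 h2
  rw [← φ.left_inv h2]
  exact key _ h1

end Uniqueness

/-! ### Closedness of `θ`, constancy of `|θ|²` along `E`, and exactness. -/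

section Equivalences

variable {M : Type*} [TopologicalSpace M] [ChartedSpace E4 M] [IsManifold (𝓡 4) ∞ M]
  {cov : Connection M}
  [RiemannianBundle (fun x : M ↦ TangentSpace (𝓡 4) x)]
  [IsContMDiffRiemannianBundle (𝓡 4) ∞ E4 (fun x : M ↦ TangentSpace (𝓡 4) x)]
  {J : EndField M}

namespace IsAdaptedFrame

variable {U : Set M} {e : Fin 4 → TangentField M} (he : IsAdaptedFrame cov J U e) {y : M}
  (hcov : IsLeviCivita cov) (hJ : IsKahler cov J)
  (hD : ∀ x : M, Module.finrank ℝ (nullity cov x) = 2)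

include he hcov hJ hD

lemma mixed_eq_zero_of_isClosedOne (h : IsClosedOne (theta cov)) (hy : y ∈ U) (i : Fin 4)
    (hi : i = 0 ∨ i = 1) : mixedTwo cov e i y = 0 ∧ mixedThree cov e i y = 0 := by
  have k2 := h y (e i) (e 2) (he.smooth i y hy) (he.smooth 2 y hy)
  have k3 := h y (e i) (e 3) (he.smooth i y hy) (he.smooth 3 y hy)
  rw [he.extDerivOne_eq hcov hJ hD hy (he.smooth i y hy) (he.smooth _ y hy)] at k2 k3
  rcases hi with rfl | rfl <;>
  · simp only [he.inner_eq hy, Fin.isValue, Fin.reduceEq, if_true, if_false] at k2 k3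
    constructor <;> linarith

lemma extDerivOne_eq_zero (h0 : ∀ i : Fin 4, (i = 0 ∨ i = 1) →
    mixedTwo cov e i y = 0 ∧ mixedThree cov e i y = 0) (hy : y ∈ U) {X Y : TangentField M}
    (hX : SmoothFieldAt X y) (hY : SmoothFieldAt Y y) : extDerivOne (theta cov) X Y y = 0 := by
  rw [he.extDerivOne_eq hcov hJ hD hy hX hY, (h0 0 (Or.inl rfl)).1, (h0 0 (Or.inl rfl)).2,
    (h0 1 (Or.inr rfl)).1, (h0 1 (Or.inr rfl)).2]
  ring

end IsAdaptedFrame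

variable (hcov : IsLeviCivita cov) (hJ : IsKahler cov J)
  (hD : ∀ x : M, Module.finrank ℝ (nullity cov x) = 2)

include hcov hJ hD

lemma isClosedOne_of_norm_sq (h : ∀ x : M, ∀ Y ∈ (nullity cov x)ᗮ,
    mvfderiv (𝓡 4) (fun y : M ↦ ‖thetaSharp cov y‖ ^ 2) x Y = 0) : IsClosedOne (theta cov) := by
  intro x X Y hX hY
  obtain ⟨U, e, hx, he⟩ := exists_adaptedFrame hcov hJ hD x
  refine he.extDerivOne_eq_zero hcov hJ hD (fun i hi ↦ ?_) hx hX hY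
  refine he.mixed_eq_zero hcov hJ hD hx (fun z hz ↦ ?_) (fun z hz ↦ ?_) hi
  · exact h z _ ((he.basis z hz).zero_mem (hD z))
  · refine h z _ ?_
    have := (he.basis z hz).J_zero
    rw [← this]
    exact hJ.mem_nullity_orthogonal hcov ((he.basis z hz).zero_mem (hD z))

/-- The formula valid along `D` extends to all directions: both sides vanish on `E` when `dθ = 0`.
-/
lemma norm_sq_of_isClosedOne (h : IsClosedOne (theta cov)) (x : M) (v : TangentSpace (𝓡 4) x) :
    mvfderiv (𝓡 4) (fun y : M ↦ ‖thetaSharp cov y‖ ^ 2) x v =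
      2 * (‖thetaSharp cov x‖ ^ 2 - 2 * twist cov x) * theta cov x v := by
  obtain ⟨U, e, hx, he⟩ := exists_adaptedFrame hcov hJ hD x
  have hm := he.mixed_eq_zero_of_isClosedOne hcov hJ hD h hx
  rw [he.mvfderiv_eq_sum hx, he.dir_norm_sq_nullity hcov hJ hD hx (Or.inl rfl),
    he.dir_norm_sq_nullity hcov hJ hD hx (Or.inr rfl), he.dir_norm_sq_mixed hcov hJ hD hx,
    he.dir_norm_sq_mixed hcov hJ hD hx, (hm 0 (Or.inl rfl)).1, (hm 0 (Or.inl rfl)).2,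
    (hm 1 (Or.inr rfl)).1, (hm 1 (Or.inr rfl)).2, he.theta_eq hcov hJ hD hx]
  ring

lemma twist_of_isClosedOne (h : IsClosedOne (theta cov)) (x : M) (v : TangentSpace (𝓡 4) x) :
    mvfderiv (𝓡 4) (twist cov) x v = twist cov x * theta cov x v := by
  obtain ⟨U, e, hx, he⟩ := exists_adaptedFrame hcov hJ hD x
  have hm := fun z hz ↦ he.mixed_eq_zero_of_isClosedOne hcov hJ hD h (y := z) hz
  rw [he.mvfderiv_eq_sum hx, he.dir_twist hcov hJ hD hx (Or.inl rfl),
    he.dir_twist hcov hJ hD hx (Or.inr rfl), he.dir_twist_eq_zero hcov hJ hD hx hm (Or.inl rfl),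
    he.dir_twist_eq_zero hcov hJ hD hx hm (Or.inr rfl), he.theta_eq hcov hJ hD hx]
  ring

lemma norm_sq_eq_zero_of_isClosedOne (h : IsClosedOne (theta cov)) (x : M)
    (Y : TangentSpace (𝓡 4) x) (hY : Y ∈ (nullity cov x)ᗮ) :
    mvfderiv (𝓡 4) (fun y : M ↦ ‖thetaSharp cov y‖ ^ 2) x Y = 0 := by
  rw [norm_sq_of_isClosedOne hcov hJ hD h, theta, ContinuousLinearMap.comp_apply,
    (Submodule.starProjection_apply_eq_zero_iff _).2 hY, map_zero, mul_zero]

lemma smoothNear_norm_sq (x : M) : FnSmoothNear (fun y : M ↦ ‖thetaSharp cov y‖ ^ 2) x := by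
  obtain ⟨U, e, hx, he⟩ := exists_adaptedFrame hcov hJ hD x
  exact he.near_norm_thetaSharp_sq hcov hJ hD hx

lemma smoothNear_twist (x : M) : FnSmoothNear (twist cov) x := by
  obtain ⟨U, e, hx, he⟩ := exists_adaptedFrame hcov hJ hD x
  exact he.near_twist hcov hJ hD hx

lemma exists_theta_bound (x : M) (t : ℝ) (ht : 0 ≤ t) :
    ∃ K : ℝ, 0 ≤ K ∧ ∀ᶠ y in 𝓝 x, ∀ v, |(t • theta cov y) v| ≤ K * ‖v‖ := by
  have hc := (smoothNear_norm_sq hcov hJ hD x).self.continuousAt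
  set G := ‖thetaSharp cov x‖ ^ 2
  have hG : 0 ≤ G := sq_nonneg _
  refine ⟨t * (G + 1), by positivity, ?_⟩
  filter_upwards [hc.eventually (gt_mem_nhds (lt_add_one G))] with y hy v
  have h1 : ‖thetaSharp cov y‖ ≤ G + 1 := by
    -- From `2n ≤ n² + 1` with `n² < G + 1` and `G ≥ 0`.
    nlinarith [sq_nonneg (‖thetaSharp cov y‖ - 1)]
  rw [smul_apply, smul_eq_mul, abs_mul, abs_of_nonneg ht, theta_eq_inner, mul_assoc]
  exact mul_le_mul_of_nonneg_left ((abs_real_inner_le_norm _ _).trans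
    (mul_le_mul_of_nonneg_right h1 (norm_nonneg _))) ht

lemma eventually_twist_eq_zero (h : IsClosedOne (theta cov)) {x : M} (h0 : twist cov x = 0) :
    ∀ᶠ y in 𝓝 x, twist cov y = 0 := by
  obtain ⟨K, hK0, hK⟩ := exists_theta_bound hcov hJ hD x 1 zero_le_one
  refine eventually_eq_zero_of_mvfderiv (α := fun y ↦ (1 : ℝ) • theta cov y)
    (smoothNear_twist hcov hJ hD x) (Eventually.of_forall fun y v ↦ ?_) hK0 hK h0
  rw [one_smul, twist_of_isClosedOne hcov hJ hD h]

/-- The combination `A = |θ|² - 4 twist` is chosen so that `dA = 2 A θ`, which makes `½ log A` a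
potential where `A ≠ 0`. -/
lemma eventually_norm_sq_sub_eq_zero (h : IsClosedOne (theta cov)) {x : M}
    (h0 : ‖thetaSharp cov x‖ ^ 2 - 4 * twist cov x = 0) :
    ∀ᶠ y in 𝓝 x, ‖thetaSharp cov y‖ ^ 2 - 4 * twist cov y = 0 := by
  obtain ⟨K, hK0, hK⟩ := exists_theta_bound hcov hJ hD x 2 zero_le_two
  have hn := fun y ↦ smoothNear_norm_sq hcov hJ hD y
  have ht := fun y ↦ smoothNear_twist hcov hJ hD y
  refine eventually_eq_zero_of_mvfderiv (α := fun y ↦ (2 : ℝ) • theta cov y)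
    ((hn x).sub ((FnSmoothNear.const 4 x).mul (ht x))) (Eventually.of_forall fun y v ↦ ?_) hK0 hK h0
  rw [mvfderiv_fun_sub (hn y).mdiff ((FnSmoothNear.const 4 y).mul (ht y)).mdiff,
    mvfderiv_fun_mul (FnSmoothNear.const 4 y).mdiff (ht y).mdiff]
  simp only [sub_apply, add_apply, smul_apply,
    mvfderiv_const, zero_apply, smul_eq_mul, norm_sq_of_isClosedOne hcov hJ hD h,
    twist_of_isClosedOne hcov hJ hD h]
  ring

open Classical in
/-- If `θ` is closed, then it is exact. -/
lemma exists_potential (h : IsClosedOne (theta cov)) : ∃ H : M → ℝ,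
    ContMDiff (𝓡 4) 𝓘(ℝ, ℝ) ∞ H ∧ ∀ (x : M) (v : TangentSpace (𝓡 4) x),
      mvfderiv (𝓡 4) H x v = theta cov x v := by
  set A : M → ℝ := fun y ↦ ‖thetaSharp cov y‖ ^ 2 - 4 * twist cov y with hA
  -- By the two uniqueness lemmas the sets `twist = 0` and `A = 0` are open as well as closed, so
  -- each branch of the definition is taken on an open set and `H` is smooth. In the last branch
  -- `|θ|² = 0`, so a constant is a potential for `θ`.
  let H : M → ℝ := fun x ↦ if twist cov x ≠ 0 then Real.log (twist cov x) else
    if A x ≠ 0 then 1 / 2 * Real.log (A x) else 0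
  have hn := fun y ↦ smoothNear_norm_sq hcov hJ hD y
  have ht := fun y ↦ smoothNear_twist hcov hJ hD y
  have hAs : ∀ y, FnSmoothNear A y := fun y ↦ (hn y).sub ((FnSmoothNear.const 4 y).mul (ht y))
  have main : ∀ x, FnSmoothNear H x ∧ ∀ v, mvfderiv (𝓡 4) H x v = theta cov x v := by
    intro x
    by_cases h1 : twist cov x = 0
    · have e1 := eventually_twist_eq_zero hcov hJ hD h h1
      by_cases h2 : A x = 0
      · have e2 := eventually_norm_sq_sub_eq_zero hcov hJ hD h h2
        have hH : H =ᶠ[𝓝 x] fun _ ↦ 0 := by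
          filter_upwards [e1, e2] with y k1 k2
          change A y = 0 at k2
          simp only [H, k2, k1, ne_eq, not_true_eq_false, if_false]
        refine ⟨(FnSmoothNear.const 0 x).congr hH, fun v ↦ ?_⟩
        have : thetaSharp cov x = 0 := by
          simpa [hA, h1] using h2
        rw [mvfderiv_congr hH, mvfderiv_const, theta_eq_inner, this, inner_zero_left]
        rfl
      · have hH : H =ᶠ[𝓝 x] fun y ↦ 1 / 2 * Real.log (‖thetaSharp cov y‖ ^ 2) := by
          filter_upwards [e1, (hAs x).self.continuousAt.eventually_ne h2] with y k1 k2
          simp only [H, k1, k2, ne_eq, not_true_eq_false, not_false_eq_true, if_true, if_false]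
          simp [hA, k1]
        have h2' : ‖thetaSharp cov x‖ ^ 2 ≠ 0 := by simpa [hA, h1] using h2
        have hl : FnSmoothNear (fun y ↦ Real.log (‖thetaSharp cov y‖ ^ 2)) x :=
          (hn x).comp (g := Real.log) (by
            filter_upwards [eventually_ne_nhds h2'] with t ht using Real.contDiffAt_log.2 ht)
        refine ⟨((FnSmoothNear.const _ x).mul hl).congr hH, fun v ↦ ?_⟩
        rw [mvfderiv_congr hH, mvfderiv_fun_mul (FnSmoothNear.const _ x).mdiff hl.mdiff]
        have := mvfderiv_comp_real (f := fun y ↦ ‖thetaSharp cov y‖ ^ 2) (x := x)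
          (Real.hasDerivAt_log h2') (hn x).mdiff v
        simp only [add_apply, smul_apply,
          mvfderiv_const, zero_apply, smul_eq_mul, this, norm_sq_of_isClosedOne hcov hJ hD h, h1]
        generalize ‖thetaSharp cov x‖ ^ 2 = G at h2'
        field_simp
        ring
    · have hH : H =ᶠ[𝓝 x] fun y ↦ Real.log (twist cov y) := by
        filter_upwards [(ht x).self.continuousAt.eventually_ne h1] with y k1
        simp [H, k1]
      have hl : FnSmoothNear (fun y ↦ Real.log (twist cov y)) x :=
        (ht x).comp (g := Real.log) (by
          filter_upwards [eventually_ne_nhds h1] with t ht using Real.contDiffAt_log.2 ht)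
      refine ⟨hl.congr hH, fun v ↦ ?_⟩
      rw [mvfderiv_congr hH, mvfderiv_comp_real (f := twist cov) (x := x)
          (Real.hasDerivAt_log h1) (ht x).mdiff v, twist_of_isClosedOne hcov hJ hD h]
      field_simp
  exact ⟨H, fun x ↦ (main x).1.self, fun x ↦ (main x).2⟩

omit hJ hD hcov in
/-- Locally exact 1-forms are closed. -/
lemma extDerivOne_eq_zero_of_eventually {α : OneForm M} {f : M → ℝ} {x : M}
    (hf : ContMDiffAt (𝓡 4) 𝓘(ℝ, ℝ) ∞ f x) (h : ∀ᶠ y in 𝓝 x, ∀ v, α y v = mvfderiv (𝓡 4) f y v)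
    {X Y : TangentField M} (hX : SmoothFieldAt X x) (hY : SmoothFieldAt Y x) :
    extDerivOne α X Y x = 0 := by
  have hZ : ∀ Z : TangentField M, (fun y ↦ α y (Z y)) =ᶠ[𝓝 x] dir Z f := by
    intro Z
    filter_upwards [h] with y hy using hy _
  have := dir_comm hf hX hY
  rw [extDerivOne, mvfderiv_congr (hZ X), mvfderiv_congr (hZ Y), h.self_of_nhds]
  simp only [dir] at this ⊢
  linarith

lemma fundamentalForm_thetaSharp (x : M) (w : TangentSpace (𝓡 4) x) :
    fundamentalForm J x (J x (thetaSharp cov x)) w = - theta cov x w := by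
  rw [fundamentalForm, hJ.sq, inner_neg_left, theta_eq_inner]

/-- `J² = -1` gives `Ω(Jθ^♯, ·) = -θ`, so a Hamiltonian function is minus a potential of `θ`. -/
lemma isHamiltonian_iff : IsHamiltonian (fundamentalForm J) (fun x : M ↦ J x (thetaSharp cov x)) ↔
    IsClosedOne (theta cov) := by
  constructor
  · rintro ⟨H, hH, h⟩ x X Y hX hY
    refine extDerivOne_eq_zero_of_eventually (f := fun y ↦ - H y) (hH x).neg
      (Eventually.of_forall fun y v ↦ ?_) hX hY
    have := h y v
    rw [fundamentalForm_thetaSharp hcov hJ hD] at this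
    rw [mvfderiv_fun_neg, neg_apply, ← this, neg_neg]
  · intro h
    obtain ⟨H, hH, hd⟩ := exists_potential hcov hJ hD h
    refine ⟨fun y ↦ - H y, hH.neg, fun x w ↦ ?_⟩
    rw [fundamentalForm_thetaSharp hcov hJ hD, mvfderiv_fun_neg, neg_apply, hd]

end Equivalences

/-! ### The opposite almost complex structure and conformal Kähler metrics. -/

section Opposite

variable {M : Type*} [TopologicalSpace M] [ChartedSpace E4 M] [IsManifold (𝓡 4) ∞ M]
  {cov : Connection M}
  [RiemannianBundle (fun x : M ↦ TangentSpace (𝓡 4) x)]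
  [IsContMDiffRiemannianBundle (𝓡 4) ∞ E4 (fun x : M ↦ TangentSpace (𝓡 4) x)]
  {J : EndField M}

lemma SmoothFieldAt.diff_inner {X Y : TangentField M} {x : M} (hX : SmoothFieldAt X x)
    (hY : SmoothFieldAt Y x) : DiffFnAt (fun z ↦ ⟪X z, Y z⟫_ℝ) x :=
  (ContMDiffAt.inner_bundle hX hY).mdifferentiableAt (by simp)

namespace IsAdaptedFrame

variable {U : Set M} {e : Fin 4 → TangentField M} (he : IsAdaptedFrame cov J U e) {y : M}
  (hcov : IsLeviCivita cov) (hJ : IsKahler cov J)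
  (hD : ∀ x : M, Module.finrank ℝ (nullity cov x) = 2)

include he hD hJ in
lemma fundamentalForm_opposite (hy : y ∈ U) (v w : TangentSpace (𝓡 4) y) :
    fundamentalForm (opposite cov J) y v w =
      ⟪e 2 y, v⟫_ℝ * ⟪e 3 y, w⟫_ℝ - ⟪e 3 y, v⟫_ℝ * ⟪e 2 y, w⟫_ℝ
        - (⟪e 0 y, v⟫_ℝ * ⟪e 1 y, w⟫_ℝ - ⟪e 1 y, v⟫_ℝ * ⟪e 0 y, w⟫_ℝ) := by
  have hb := he.basis y hy
  rw [fundamentalForm, opposite, ContinuousLinearMap.comp_apply, sub_apply,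
    hb.starProjection_eq (hD y), hb.starProjection_orthogonal_eq (hD y)]
  simp only [map_sub, map_add, map_smul, hb.J_zero, hb.J_one hJ, hb.J_two, hb.J_three hJ,
    inner_add_left, inner_sub_left, real_inner_smul_left, inner_neg_left]
  ring

include he hcov

lemma dir_inner_frame (hy : y ∈ U) {X Y : TangentField M} (hY : SmoothFieldAt Y y) (i : Fin 4) :
    dir X (fun z ↦ ⟪e i z, Y z⟫_ℝ) y =
      ⟪cov (e i) y (X y), Y y⟫_ℝ + ⟪e i y, cov Y y (X y)⟫_ℝ :=
  hcov.dir_inner (he.near hy i).mdiff hY.mdiff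

include hJ hD

/-- The fundamental forms satisfy `Ω_I = Ω_J - 2 e⁰ ∧ e¹` with `Ω_J` parallel, which explains the
factor 2. Only `conn 0 2` and `conn 0 3` appear, since rotations inside `E` or `D` preserve `e⁰ ∧
e¹`. -/
lemma dir_exp_mul_opposite (hy : y ∈ U) {f : M → ℝ} (hf : DiffFnAt f y) {X Y Z : TangentField M}
    (hY : SmoothFieldAt Y y) (hZ : SmoothFieldAt Z y) :
    mvfderiv (𝓡 4) (fun z ↦ Real.exp (f z) * fundamentalForm (opposite cov J) z (Y z) (Z z)) y (X y) =
      Real.exp (f y) * (mvfderiv (𝓡 4) f y (X y) *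
          fundamentalForm (opposite cov J) y (Y y) (Z y)
        + fundamentalForm (opposite cov J) y (cov Y y (X y)) (Z y)
        + fundamentalForm (opposite cov J) y (Y y) (cov Z y (X y))
        - 2 * (⟪e 1 y, Z y⟫_ℝ * (conn cov e 0 2 y (X y) * ⟪e 2 y, Y y⟫_ℝ
              + conn cov e 0 3 y (X y) * ⟪e 3 y, Y y⟫_ℝ)
            - ⟪e 1 y, Y y⟫_ℝ * (conn cov e 0 2 y (X y) * ⟪e 2 y, Z y⟫_ℝ
              + conn cov e 0 3 y (X y) * ⟪e 3 y, Z y⟫_ℝ)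
            + ⟪e 0 y, Y y⟫_ℝ * (conn cov e 0 2 y (X y) * ⟪e 3 y, Z y⟫_ℝ
              - conn cov e 0 3 y (X y) * ⟪e 2 y, Z y⟫_ℝ)
            - ⟪e 0 y, Z y⟫_ℝ * (conn cov e 0 2 y (X y) * ⟪e 3 y, Y y⟫_ℝ
              - conn cov e 0 3 y (X y) * ⟪e 2 y, Y y⟫_ℝ))) := by
  have hY' := fun i ↦ (he.smooth i y hy).diff_inner hY
  have hZ' := fun i ↦ (he.smooth i y hy).diff_inner hZ
  have hexp : DiffFnAt (fun z ↦ Real.exp (f z)) y :=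
    (Real.differentiable_exp _).mdifferentiableAt.comp y hf
  have hcongr : (fun z ↦ Real.exp (f z) * fundamentalForm (opposite cov J) z (Y z) (Z z)) =ᶠ[𝓝 y]
      fun z ↦ Real.exp (f z) * (⟪e 2 z, Y z⟫_ℝ * ⟪e 3 z, Z z⟫_ℝ - ⟪e 3 z, Y z⟫_ℝ * ⟪e 2 z, Z z⟫_ℝ
        - (⟪e 0 z, Y z⟫_ℝ * ⟪e 1 z, Z z⟫_ℝ - ⟪e 1 z, Y z⟫_ℝ * ⟪e 0 z, Z z⟫_ℝ)) := by
    filter_upwards [he.isOpen.mem_nhds hy] with z hz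
    rw [he.fundamentalForm_opposite hJ hD hz]
  have hp : ∀ i j, DiffFnAt (fun z ↦ ⟪e i z, Y z⟫_ℝ * ⟪e j z, Z z⟫_ℝ) y :=
    fun i j ↦ (hY' i).mul (hZ' j)
  have hq : ∀ i j, DiffFnAt (fun z ↦ ⟪e i z, Y z⟫_ℝ * ⟪e j z, Z z⟫_ℝ
      - ⟪e j z, Y z⟫_ℝ * ⟪e i z, Z z⟫_ℝ) y := fun i j ↦ (hp i j).sub (hp j i)
  have hr : DiffFnAt (fun z ↦ ⟪e 2 z, Y z⟫_ℝ * ⟪e 3 z, Z z⟫_ℝ - ⟪e 3 z, Y z⟫_ℝ * ⟪e 2 z, Z z⟫_ℝ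
        - (⟪e 0 z, Y z⟫_ℝ * ⟪e 1 z, Z z⟫_ℝ - ⟪e 1 z, Y z⟫_ℝ * ⟪e 0 z, Z z⟫_ℝ)) y :=
    (hq 2 3).sub (hq 0 1)
  have hder : dir X (fun z ↦ Real.exp (f z)) y = Real.exp (f y) * mvfderiv (𝓡 4) f y (X y) :=
    mvfderiv_comp_real (Real.hasDerivAt_exp _) hf _
  change dir X _ y = _
  rw [dir_congr hcongr, dir_mul hexp hr, hder, dir_sub (hq 2 3) (hq 0 1), dir_sub (hp 2 3) (hp 3 2),
    dir_sub (hp 0 1) (hp 1 0), dir_mul (hY' 2) (hZ' 3), dir_mul (hY' 3) (hZ' 2),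
    dir_mul (hY' 0) (hZ' 1), dir_mul (hY' 1) (hZ' 0)]
  simp only [he.dir_inner_frame hcov hy hY, he.dir_inner_frame hcov hy hZ,
    he.cov_zero_eq hcov hy, he.cov_one_eq hcov hJ hy, he.cov_two_eq hcov hJ hy,
    he.cov_three_eq hcov hJ hy, he.fundamentalForm_opposite hJ hD hy, inner_add_left, inner_sub_left,
    real_inner_smul_left]
  ring

/-- The exterior derivative of the fundamental form of `(e^f g, I)` in an adapted frame. -/
lemma extDerivTwo_opposite (hy : y ∈ U) {f : M → ℝ} (hf : DiffFnAt f y) {X Y Z : TangentField M}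
    (hX : SmoothFieldAt X y) (hY : SmoothFieldAt Y y) (hZ : SmoothFieldAt Z y) :
    extDerivTwo (fun x v w ↦ Real.exp (f x) * fundamentalForm (opposite cov J) x v w) X Y Z y =
      Real.exp (f y) *
        (mvfderiv (𝓡 4) f y (X y) * fundamentalForm (opposite cov J) y (Y y) (Z y)
          + mvfderiv (𝓡 4) f y (Y y) * fundamentalForm (opposite cov J) y (Z y) (X y)
          + mvfderiv (𝓡 4) f y (Z y) * fundamentalForm (opposite cov J) y (X y) (Y y)
        + 2 * (theta cov y (X y) * (⟪e 0 y, Y y⟫_ℝ * ⟪e 1 y, Z y⟫_ℝ - ⟪e 1 y, Y y⟫_ℝ * ⟪e 0 y, Z y⟫_ℝ)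
          + theta cov y (Y y) * (⟪e 0 y, Z y⟫_ℝ * ⟪e 1 y, X y⟫_ℝ - ⟪e 1 y, Z y⟫_ℝ * ⟪e 0 y, X y⟫_ℝ)
          + theta cov y (Z y) *
            (⟪e 0 y, X y⟫_ℝ * ⟪e 1 y, Y y⟫_ℝ - ⟪e 1 y, X y⟫_ℝ * ⟪e 0 y, Y y⟫_ℝ))) := by
  -- Zero torsion cancels the derivatives of the fields against the bracket terms. What remains of
  -- `dΩ_I` is `-2 d(e⁰ ∧ e¹) = 2 θ ∧ e⁰ ∧ e¹`.
  have t1 : mlieBracket (𝓡 4) X Y y = _ := hcov.torsion hX.mdiff hY.mdiff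
  have t2 : mlieBracket (𝓡 4) Y Z y = _ := hcov.torsion hY.mdiff hZ.mdiff
  have t3 : mlieBracket (𝓡 4) Z X y = _ := hcov.torsion hZ.mdiff hX.mdiff
  simp only [extDerivTwo]
  rw [t1, t2, t3, he.dir_exp_mul_opposite hcov hJ hD hy hf hY hZ,
    he.dir_exp_mul_opposite hcov hJ hD hy hf hZ hX, he.dir_exp_mul_opposite hcov hJ hD hy hf hX hY]
  simp only [he.conn_eq hcov hJ hD (Or.inl rfl) hy, he.conn_eq hcov hJ hD (Or.inr rfl) hy,
    he.theta_eq hcov hJ hD hy, he.thetaCoef_two hcov hJ hy, he.thetaCoef_three hcov hJ hy,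
    he.fundamentalForm_opposite hJ hD hy, inner_sub_right]
  ring

lemma mvfderiv_eq_two_mul_theta (hy : y ∈ U) {f : M → ℝ} (hf : DiffFnAt f y)
    (h : ∀ X Y Z : TangentField M, SmoothFieldAt X y → SmoothFieldAt Y y → SmoothFieldAt Z y →
      extDerivTwo (fun x v w ↦ Real.exp (f x) * fundamentalForm (opposite cov J) x v w) X Y Z y = 0)
    (v : TangentSpace (𝓡 4) y) : mvfderiv (𝓡 4) f y v = 2 * theta cov y v := by
  have key : ∀ i j k : Fin 4, _ = (0 : ℝ) := fun i j k ↦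
    (he.extDerivTwo_opposite hcov hJ hD hy hf (he.smooth i y hy) (he.smooth j y hy)
      (he.smooth k y hy)).symm.trans
      (h _ _ _ (he.smooth i y hy) (he.smooth j y hy) (he.smooth k y hy))
  -- The four frame components of a 3-form in dimension 4: `(0,2,3)` and `(1,2,3)` kill `df` on `E`,
  -- while `(2,0,1)` and `(3,0,1)` give `df = 2θ` on `D`.
  have k0 := (mul_eq_zero.1 (key 0 2 3)).resolve_left (Real.exp_ne_zero _)
  have k1 := (mul_eq_zero.1 (key 1 2 3)).resolve_left (Real.exp_ne_zero _)
  have k2 := (mul_eq_zero.1 (key 2 0 1)).resolve_left (Real.exp_ne_zero _)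
  have k3 := (mul_eq_zero.1 (key 3 0 1)).resolve_left (Real.exp_ne_zero _)
  simp only [he.fundamentalForm_opposite hJ hD hy, he.theta_eq hcov hJ hD hy, he.inner_eq hy,
    Fin.isValue, Fin.reduceEq, if_true, if_false] at k0 k1 k2 k3
  rw [he.mvfderiv_eq_sum hy, he.theta_eq hcov hJ hD hy]
  simp only [dir]
  linear_combination ⟪e 0 y, v⟫_ℝ * k0 + ⟪e 1 y, v⟫_ℝ * k1 - ⟪e 2 y, v⟫_ℝ * k2 - ⟪e 3 y, v⟫_ℝ * k3

end IsAdaptedFrame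

variable (hcov : IsLeviCivita cov) (hJ : IsKahler cov J)
  (hD : ∀ x : M, Module.finrank ℝ (nullity cov x) = 2)

include hcov hJ hD

lemma isClosedOne_of_isLocallyConformallyKahler
    (h : IsLocallyConformallyKahler (opposite cov J)) : IsClosedOne (theta cov) := by
  intro x X Y hX hY
  obtain ⟨V, hV, hxV, f, hf, hc⟩ := h.2 x
  obtain ⟨U, e, hx, he⟩ := exists_adaptedFrame hcov hJ hD x
  have hfx : FnSmoothNear f x := by
    filter_upwards [hV.mem_nhds hxV] with z hz using hf.contMDiffAt (hV.mem_nhds hz)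
  have hsmooth := (FnSmoothNear.const (1 / 2) x).mul hfx
  refine extDerivOne_eq_zero_of_eventually hsmooth.self ?_ hX hY
  filter_upwards [hV.mem_nhds hxV, he.isOpen.mem_nhds hx, hfx.eventually] with z hzV hzU hfz v
  rw [mvfderiv_fun_mul (FnSmoothNear.const _ z).mdiff hfz.mdiff]
  simp only [add_apply, smul_apply, mvfderiv_const, zero_apply, smul_eq_mul,
    he.mvfderiv_eq_two_mul_theta hcov hJ hD hzU hfz.mdiff (hc z hzV)]
  ring

/-- Take `f = 2H` for a global potential `H` of `θ`. Then `df ∧ Ω_I + 2 θ ∧ e⁰ ∧ e¹` reduces to `2 θ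
∧ e² ∧ e³`, which is zero because `θ` vanishes on `E`. -/
lemma isLocallyConformallyKahler_of_isClosedOne (hI : IsIntegrable (opposite cov J))
    (h : IsClosedOne (theta cov)) : IsLocallyConformallyKahler (opposite cov J) := by
  obtain ⟨H, hH, hd⟩ := exists_potential hcov hJ hD h
  refine ⟨hI, fun p ↦ ⟨Set.univ, isOpen_univ, Set.mem_univ p, fun x ↦ 2 * H x, ?_, ?_⟩⟩
  · exact (contMDiff_const.mul hH).contMDiffOn
  · intro x _ X Y Z hX hY hZ
    obtain ⟨U, e, hx, he⟩ := exists_adaptedFrame hcov hJ hD x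
    have hHx : DiffFnAt H x := (hH x).mdifferentiableAt (by simp)
    have h2 : ∀ v, mvfderiv (𝓡 4) (fun x ↦ 2 * H x) x v = 2 * theta cov x v := by
      intro v
      rw [mvfderiv_fun_mul (FnSmoothNear.const _ x).mdiff hHx]
      simp only [add_apply, smul_apply, mvfderiv_const, zero_apply, smul_eq_mul, hd]
      ring
    rw [he.extDerivTwo_opposite hcov hJ hD hx (f := fun x ↦ 2 * H x)
      ((FnSmoothNear.const 2 x).mdiff.mul hHx) hX hY hZ]
    simp only [h2, he.fundamentalForm_opposite hJ hD hx, he.theta_eq hcov hJ hD hx]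
    ring

end Opposite

end KahlerSurface

theorem mainTheorem11 {M : Type*} [TopologicalSpace M] [T2Space M]
    [ChartedSpace KahlerSurface.E4 M] [IsManifold (𝓡 4) ∞ M]
    [RiemannianBundle (fun x : M ↦ TangentSpace (𝓡 4) x)]
    [IsContMDiffRiemannianBundle (𝓡 4) ∞ KahlerSurface.E4 (fun x : M ↦ TangentSpace (𝓡 4) x)]
    (cov : KahlerSurface.Connection M) (hcov : KahlerSurface.IsLeviCivita cov)
    (J : KahlerSurface.EndField M)
    (hJ : KahlerSurface.IsKahler cov J)
    (hR : KahlerSurface.IsSemiSymmetric cov)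
    (hD : ∀ x : M, Module.finrank ℝ (KahlerSurface.nullity cov x) = 2) :
    List.TFAE [
      KahlerSurface.IsClosedOne (KahlerSurface.theta cov),
      KahlerSurface.IsHamiltonian (KahlerSurface.fundamentalForm J)
        (fun x : M ↦ J x (KahlerSurface.thetaSharp cov x)),
      ∀ (x : M), ∀ Y ∈ (KahlerSurface.nullity cov x)ᗮ,
        mvfderiv (𝓡 4) (fun y : M ↦ ‖KahlerSurface.thetaSharp cov y‖ ^ 2) x Y = 0] ∧
    (KahlerSurface.IsIntegrable (KahlerSurface.opposite cov J) →
      List.TFAE [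
        KahlerSurface.IsClosedOne (KahlerSurface.theta cov),
        KahlerSurface.IsHamiltonian (KahlerSurface.fundamentalForm J)
          (fun x : M ↦ J x (KahlerSurface.thetaSharp cov x)),
        ∀ (x : M), ∀ Y ∈ (KahlerSurface.nullity cov x)ᗮ,
          mvfderiv (𝓡 4) (fun y : M ↦ ‖KahlerSurface.thetaSharp cov y‖ ^ 2) x Y = 0,
        KahlerSurface.IsLocallyConformallyKahler (KahlerSurface.opposite cov J)]) := by
  have hab := (KahlerSurface.isHamiltonian_iff hcov hJ hD).symm
  have hac : KahlerSurface.IsClosedOne (KahlerSurface.theta cov) ↔ ∀ (x : M),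
      ∀ Y ∈ (KahlerSurface.nullity cov x)ᗮ,
        mvfderiv (𝓡 4) (fun y : M ↦ ‖KahlerSurface.thetaSharp cov y‖ ^ 2) x Y = 0 :=
    ⟨KahlerSurface.norm_sq_eq_zero_of_isClosedOne hcov hJ hD,
      KahlerSurface.isClosedOne_of_norm_sq hcov hJ hD⟩
  refine ⟨?_, fun hI ↦ ?_⟩
  · tfae_have 1 ↔ 2 := hab
    tfae_have 1 ↔ 3 := hac
    tfae_finish
  · tfae_have 1 ↔ 2 := hab
    tfae_have 1 ↔ 3 := hac
    tfae_have 1 ↔ 4 := ⟨KahlerSurface.isLocallyConformallyKahler_of_isClosedOne hcov hJ hD hI,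
      KahlerSurface.isClosedOne_of_isLocallyConformallyKahler hcov hJ hD⟩
    tfae_finish
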